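/- **Theorem 1.2.** Let $N\ge 1$, $0<s<1$, and let $(-\Delta)^{s}$ be the Fourier multiplier with symbol $|\zeta|^{2s}$ on $\mathbb{R}^N$. Let $H^s(\mathbb{R}^N)$ be the space of real-valued $u\in L^2(\mathbb{R}^N)$ with $(-\Delta)^{s/2}u\in L^2(\mathbb{R}^N)$, with norm $\|u\|_{H^s}=\big(\int_{\mathbb{R}^N}|(-\Delta)^{s/2}u|^2+|u|^2\,dx\big)^{1/2}$. Assume: - $V:\mathbb{R}^N\to[0,\infty)$ is continuous; for some $b>0$ the set $\{x: V(x)<b\}$ is nonempty and has finite Lebesgue measure; $\Omega:=\operatorname{int}V^{-1}(0)$ is nonempty, has smooth boundary, and $\overline\Omega=V^{-1}(0)$. - $f:\mathbb{R}^N\times\mathbb{R}\to\mathbb{R}$ is continuous, and there are $1<p<2$ and $0\le\xi\in L^{2/(2-p)}(\mathbb{R}^N)$ with $|f(x,t)|\le\xi(x)|t|^{p-1}$ for almost every $x\in\mathbb{R}^N$ and all $t\in\mathbb{R}$. - There are $\eta,\delta>0$ and $\gamma\in(1,2)$ such that $F(x,t):=\int_0^t f(x,\tau)\,d\tau\ \ge\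 \eta|t|^\gamma$ for all $x\in\Omega$ and $|t|\le\delta$. For $\lambda>0$ let $E=\{u\in H^s(\mathbb{R}^N):\int V u^2<\infty\}$ and $$J_\lambda(u)=\tfrac12\int_{\mathbb{R}^N}|(-\Delta)^{s/2}u|^2dx+\tfrac{\lambda}{2}\int_{\mathbb{R}^N}Vu^2dx-\int_{\mathbb{R}^N}F(x,u)\,dx\qquad(u\in E).$$ A minimizing solution for $\lambda$ is a $u\in E$ with $J_\lambda(u)=\inf_E J_\lambda$ that is a weak solution of $(-\Delta)^su+\lambda V u=f(x,u)$ in $\mathbb{R}^N$, i.e. $\int(-\Delta)^{s/2}u\,(-\Delta)^{s/2}v+\lambda\int Vuv=\int f(x,u)v$ for all $v\in E$. Let $\lambda_n>0$ with $\lambda_n\to\infty$, and for each $n$ let $u_n$ be a minimizing solution for $\lambda_n$. Then $(u_n)$ has a subsequence that converges strongly in $H^s(\mathbb{R}^N)$ to some $u_0\neq0$ which is a weak solution of $$(-\Delta)^su=f(x,u)\ \text{ in }\Omega,\qquad u=0\ \text{ in }\mathbb{R}^N\setminus\Omega,$$ i.e. $u_0\in H^s(\mathbb{R}^N)$, $u_0=0$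 a.e. in $\mathbb{R}^N\setminus\Omega$, and $\int_{\mathbb{R}^N}(-\Delta)^{s/2}u_0\,(-\Delta)^{s/2}v\,dx=\int_\Omega f(x,u_0)v\,dx$ for all $v\in H^s(\mathbb{R}^N)$ with $v=0$ a.e. in $\mathbb{R}^N\setminus\Omega$. Moreover the whole sequence concentrates on $V^{-1}(0)$: $\int_{\mathbb{R}^N\setminus V^{-1}(0)}|u_n|^2\,dx\to0$. -/

import Mathlib

open MeasureTheory Filter Topology FourierTransform
open scoped ContDiff

noncomputable section

namespace FracSchrodinger

/-- `L²(ℝᴺ; ℝ)`. -/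
abbrev L2R (N : ℕ) : Type :=
  Lp ℝ 2 (volume : Measure (EuclideanSpace ℝ (Fin N)))

/-- `L²(ℝᴺ; ℂ)`. -/
abbrev L2C (N : ℕ) : Type :=
  Lp ℂ 2 (volume : Measure (EuclideanSpace ℝ (Fin N)))

variable {N : ℕ}

/-- The Fourier transform on `L²` of a real-valued function. Mathlib's normalisation is
`𝓕 u (k) = ∫ exp (-2πi ⟨x, k⟩) u x dx`. -/
def fourierReal (u : L2R N) : L2C N :=
  𝓕 (Complex.ofRealCLM.compLp u : L2C N)

/-- The Fourier side of the fractional Laplacian: `k ↦ |2πk|^{2σ} 𝓕 u (k)`. The factor `2π` is due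
to the normalisation of the Fourier transform: with `ζ = 2πk` this is the multiplier `|ζ|^{2σ}`. -/
def fracSymbolMul (σ : ℝ) (u : L2R N) : EuclideanSpace ℝ (Fin N) → ℂ :=
  fun k => (((2 * Real.pi * ‖k‖) ^ (2 * σ) : ℝ) : ℂ) * fourierReal u k

open Classical in
/-- `(-Δ)^σ u`, the `L²` function with Fourier transform `|2πk|^{2σ} 𝓕 u (k)`, for those `u ∈ L²` for
which this is an `L²` function (and `0` otherwise). -/
def fracLaplacian (σ : ℝ) (u : L2R N) : L2C N :=
  if h : MemLp (fracSymbolMul σ u) 2 volume then 𝓕⁻ (h.toLp (fracSymbolMul σ u)) else 0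

/-- `u ∈ H^s(ℝᴺ)`: both `u` and `(-Δ)^{s/2} u` are in `L²`. -/
def MemHs (s : ℝ) (u : L2R N) : Prop :=
  MemLp (fracSymbolMul (s / 2) u) 2 volume

/-- The norm `(∫ |(-Δ)^{s/2} u|² + |u|²)^{1/2}` of `H^s(ℝᴺ)`. -/
def hsNorm (s : ℝ) (u : L2R N) : ℝ :=
  Real.sqrt (‖fracLaplacian (s / 2) u‖ ^ 2 + ‖u‖ ^ 2)

/-- The bilinear form `∫ (-Δ)^{s/2} u (-Δ)^{s/2} v` of `(-Δ)^s`. -/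
def hsForm (s : ℝ) (u v : L2R N) : ℝ :=
  (inner ℂ (fracLaplacian (s / 2) u) (fracLaplacian (s / 2) v)).re

/-- The primitive `F(x, t) = ∫₀ᵗ f(x, τ) dτ`. -/
def primitiveF (f : EuclideanSpace ℝ (Fin N) → ℝ → ℝ) (x : EuclideanSpace ℝ (Fin N)) (t : ℝ) : ℝ :=
  ∫ τ in (0 : ℝ)..t, f x τ

/-- The energy space `{u ∈ H^s(ℝᴺ) : ∫ V u² < ∞}`; it is the same for all `λ > 0`. -/
def MemEnergySpace (s : ℝ) (V : EuclideanSpace ℝ (Fin N) → ℝ) (u : L2R N) : Prop :=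
  MemHs s u ∧ Integrable (fun x => V x * u x ^ 2) volume

/-- The energy
`½ ∫ |(-Δ)^{s/2} u|² + (λ/2) ∫ V u² - ∫ F(x, u)`. -/
def energy (s lam : ℝ) (V : EuclideanSpace ℝ (Fin N) → ℝ)
    (f : EuclideanSpace ℝ (Fin N) → ℝ → ℝ) (u : L2R N) : ℝ :=
  1 / 2 * ‖fracLaplacian (s / 2) u‖ ^ 2 + lam / 2 * (∫ x, V x * u x ^ 2)
    - ∫ x, primitiveF f x (u x)

/-- `u` is a weak solution of `(-Δ)^s u + λ V u = f(x, u)` in `ℝᴺ`. -/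
def IsWeakSolution (s lam : ℝ) (V : EuclideanSpace ℝ (Fin N) → ℝ)
    (f : EuclideanSpace ℝ (Fin N) → ℝ → ℝ) (u : L2R N) : Prop :=
  MemEnergySpace s V u ∧
    ∀ v : L2R N, MemEnergySpace s V v →
      hsForm s u v + lam * (∫ x, V x * u x * v x) = ∫ x, f x (u x) * v x

/-- `u` is a weak solution of `(-Δ)^s u + λ V u = f(x, u)` at which the energy attains its infimum
over the energy space. -/
def IsMinimizingSolution (s lam : ℝ) (V : EuclideanSpace ℝ (Fin N) → ℝ)
    (f : EuclideanSpace ℝ (Fin N) → ℝ → ℝ) (u : L2R N) : Prop :=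
  IsWeakSolution s lam V f u ∧
    ∀ v : L2R N, MemEnergySpace s V v → energy s lam V f u ≤ energy s lam V f v

/-- `u ∈ H^s(ℝᴺ)` and `u = 0` a.e. outside `Ω`. -/
def MemHsZero (s : ℝ) (Ω : Set (EuclideanSpace ℝ (Fin N))) (u : L2R N) : Prop :=
  MemHs s u ∧ ∀ᵐ x ∂(volume : Measure (EuclideanSpace ℝ (Fin N))), x ∉ Ω → u x = 0

/-- `u` is a weak solution of `(-Δ)^s u = f(x, u)` in `Ω`, `u = 0` outside `Ω`. -/
def IsWeakDirichletSolution (s : ℝ) (Ω : Set (EuclideanSpace ℝ (Fin N)))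
    (f : EuclideanSpace ℝ (Fin N) → ℝ → ℝ) (u : L2R N) : Prop :=
  MemHsZero s Ω u ∧
    ∀ v : L2R N, MemHsZero s Ω v → hsForm s u v = ∫ x in Ω, f x (u x) * v x

/-- The open set `Ω` has smooth boundary: near each boundary point, `Ω` is the negativity set of a
`C^∞` function without critical points. -/
def HasSmoothBoundary (Ω : Set (EuclideanSpace ℝ (Fin N))) : Prop :=
  ∀ x ∈ frontier Ω, ∃ U : Set (EuclideanSpace ℝ (Fin N)), IsOpen U ∧ x ∈ U ∧
    ∃ φ : EuclideanSpace ℝ (Fin N) → ℝ, ContDiffOn ℝ ∞ φ U ∧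
      (∀ y ∈ U, fderiv ℝ φ y ≠ 0) ∧ Ω ∩ U = {y | y ∈ U ∧ φ y < 0}

end FracSchrodinger

end

namespace FracSchrodinger

/-! Testing the equation with `u n` itself, together with `p < 2` and the coercivity estimate
`exists_norm_sq_le`, bounds `u n` in `H^s` uniformly in `λ ≥ 1` and bounds `λ ∫ V u²` as well
(`exists_weakSolution_bound`). Hence `∫ V (u n)² → 0`. By Chebyshev no mass stays on `{V ≥ c}`; the
shell `{0 < V < c}` has small measure, where `H^s`-bounded functions carry little `L²` mass
(`exists_setIntegral_sq_lt`). This is the concentration claim.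

Since `V⁻¹(0)` has finite measure, local Rellich compactness gives an `L²`-convergent subsequence.
Its limit `u₀` vanishes off `V⁻¹(0)`, hence off `Ω`, because the smooth boundary is null. Testing
with `u n - u₀` leaves a nonnegative potential term, as `V u₀ = 0`; Hölder and weak convergence of
the half Laplacians then give convergence in `H^s`. Test functions supported in `Ω` do not see `V`,
so the equation passes to the limit.

Finally `u₀ ≠ 0`: since `γ < 2`, a small multiple of a bump in `Ω` has negative energy independent
of `λ`, whereas `L²` convergence to `0` would force the minimal energies to have nonnegative lower
limit.

The compactness and smallness estimates all come from one device, `setIntegral_sq_le_low_add_high`: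
low frequencies are controlled pointwise by pairing with truncated plane waves, high ones by the
seminorm. -/

theorem continuous_neg_innerₗ (V : Type*) [NormedAddCommGroup V] [InnerProductSpace ℝ V] :
    Continuous fun p : V × V => (-innerₗ V) p.1 p.2 := by
  change Continuous fun p : V × V => -inner ℝ p.1 p.2
  fun_prop

/-! ### Inverse Fourier integrals on `L¹ ∩ L²` -/

section FourierInversion

variable {V : Type*} [NormedAddCommGroup V] [InnerProductSpace ℝ V] [FiniteDimensional ℝ V]
  [MeasurableSpace V] [BorelSpace V]

theorem continuous_fourierInv_of_integrable {g : V → ℂ} (hg : Integrable g) :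
    Continuous (𝓕⁻ g) :=
  VectorFourier.fourierIntegral_continuous Real.continuous_fourierChar
    (continuous_neg_innerₗ V) hg

theorem integral_fourierInv_smul_eq_of_integrable {φ g : V → ℂ} (hφ : Integrable φ)
    (hg : Integrable g) : ∫ k, 𝓕⁻ φ k • g k = ∫ x, φ x • 𝓕⁻ g x := by
  have h := VectorFourier.integral_fourierIntegral_smul_eq_flip (L := -innerₗ V)
    Real.continuous_fourierChar (continuous_neg_innerₗ V) hφ hg
  have hflip : (-innerₗ V).flip = -innerₗ V := by
    ext x y
    exact congrArg Neg.neg (real_inner_comm x y)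
  rw [hflip] at h
  exact h

/-- On `L¹ ∩ L²` the inverse Fourier transform of `L²` is the inverse Fourier integral. -/
theorem fourierInv_Lp_ae_eq (g : Lp ℂ 2 (volume : Measure V)) (hg : Integrable g) :
    ((𝓕⁻ g : Lp ℂ 2 (volume : Measure V)) : V → ℂ) =ᵐ[volume] 𝓕⁻ (g : V → ℂ) := by
  -- Both sides are compared as distributions: the `L²` transform agrees with the tempered one, and
  -- symmetry of the kernel moves the integral transform from the test function to `g`.
  refine ae_eq_of_integral_contDiff_smul_eq
    ((Lp.memLp (𝓕⁻ g : Lp ℂ 2 (volume : Measure V))).locallyIntegrable (by norm_num))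
    (continuous_fourierInv_of_integrable hg).locallyIntegrable ?_
  intro φ hφ hφc
  have hΦc : HasCompactSupport (fun x => (φ x : ℂ)) := hφc.comp_left Complex.ofReal_zero
  have hΦ : ContDiff ℝ ∞ (fun x => (φ x : ℂ)) := Complex.ofRealCLM.contDiff.comp hφ
  let Φ : SchwartzMap V ℂ := hΦc.toSchwartzMap hΦ
  have hΦapp : ∀ x, Φ x = (φ x : ℂ) := fun x => rfl
  have h1 : (𝓕⁻ (g : TemperedDistribution V ℂ)) Φ
      = ((𝓕⁻ g : Lp ℂ 2 (volume : Measure V)) : TemperedDistribution V ℂ) Φ := by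
    rw [Lp.fourierInv_toTemperedDistribution_eq]
  rw [TemperedDistribution.fourierInv_apply, Lp.toTemperedDistribution_apply,
    Lp.toTemperedDistribution_apply, SchwartzMap.fourierInv_coe,
    integral_fourierInv_smul_eq_of_integrable (Φ.integrable (μ := volume)) hg] at h1
  simpa [hΦapp] using h1.symm

end FourierInversion

/-! ### `L²` norms, frequency cutoffs and truncated plane waves -/

section L2

variable {α 𝕜 : Type*} [MeasurableSpace α] {μ : Measure α} [RCLike 𝕜]

theorem integrable_norm_sq (g : Lp 𝕜 2 μ) : Integrable (fun x => ‖g x‖ ^ 2) μ :=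
  (memLp_two_iff_integrable_sq_norm (Lp.aestronglyMeasurable g)).1 (Lp.memLp g)

theorem norm_sq_eq_integral (g : Lp 𝕜 2 μ) : ‖g‖ ^ 2 = ∫ x, ‖g x‖ ^ 2 ∂μ := by
  have h := L2.inner_def (𝕜 := 𝕜) g g
  rw [inner_self_eq_norm_sq_to_K] at h
  have h2 : ∫ x, inner 𝕜 (g x) (g x) ∂μ = ((∫ x, ‖g x‖ ^ 2 ∂μ : ℝ) : 𝕜) := by
    rw [← integral_ofReal]
    refine integral_congr_ae (Eventually.of_forall fun x => ?_)
    simp only [inner_self_eq_norm_sq_to_K]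
    push_cast
    rfl
  rw [h2] at h
  exact_mod_cast h

theorem setIntegral_norm_sq_le (g : Lp 𝕜 2 μ) (S : Set α) :
    ∫ x in S, ‖g x‖ ^ 2 ∂μ ≤ ‖g‖ ^ 2 := by
  rw [norm_sq_eq_integral]
  exact setIntegral_le_integral (integrable_norm_sq g) (Eventually.of_forall fun x => by positivity)

end L2

variable {N : ℕ}

theorem ae_ofReal (u : L2R N) :
    ∀ᵐ x, (Complex.ofRealCLM.compLp u : L2C N) x = (u x : ℂ) := by
  filter_upwards [Complex.ofRealCLM.coeFn_compLp u] with x hx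
  simpa using hx

theorem fourierReal_sub (u v : L2R N) :
    fourierReal (u - v) = fourierReal u - fourierReal v := by
  have h : (Complex.ofRealCLM.compLp (u - v) : L2C N)
      = Complex.ofRealCLM.compLp u - Complex.ofRealCLM.compLp v :=
    (Complex.ofRealCLM.compLpₗ 2 volume).map_sub u v
  rw [fourierReal, h]
  exact (Lp.fourierTransformₗᵢ (EuclideanSpace ℝ (Fin N)) ℂ).map_sub _ _

theorem norm_fourierReal (u : L2R N) : ‖fourierReal u‖ = ‖u‖ := by
  rw [fourierReal, Lp.norm_fourier_eq, ← sq_eq_sq₀ (norm_nonneg _) (norm_nonneg _),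
    norm_sq_eq_integral, norm_sq_eq_integral]
  refine integral_congr_ae ?_
  filter_upwards [ae_ofReal u] with x hx
  rw [hx]
  simp

theorem fourierInv_fourierReal (u : L2R N) :
    (𝓕⁻ (fourierReal u) : L2C N) = Complex.ofRealCLM.compLp u :=
  FourierTransform.fourierInv_fourier_eq _

theorem norm_fourierInv (g : L2C N) : ‖(𝓕⁻ g : L2C N)‖ = ‖g‖ :=
  (Lp.fourierTransformₗᵢ (EuclideanSpace ℝ (Fin N)) ℂ).symm.norm_map g

theorem fourierInv_sub (g h : L2C N) : (𝓕⁻ (g - h) : L2C N) = 𝓕⁻ g - 𝓕⁻ h :=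
  (Lp.fourierTransformₗᵢ (EuclideanSpace ℝ (Fin N)) ℂ).symm.map_sub g h

/-- Restriction of a function on the Fourier side to the frequencies `‖k‖ < R`. -/
noncomputable def cutoff (R : ℝ) (g : L2C N) : L2C N :=
  ((Lp.memLp g).indicator (s := Metric.ball 0 R) measurableSet_ball).toLp _

theorem cutoff_ae (R : ℝ) (g : L2C N) :
    cutoff R g =ᵐ[volume] (Metric.ball 0 R).indicator g :=
  MemLp.coeFn_toLp _

theorem norm_sub_cutoff_sq (R : ℝ) (g : L2C N) :
    ‖g - cutoff R g‖ ^ 2 = ∫ k in (Metric.ball 0 R)ᶜ, ‖g k‖ ^ 2 := by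
  rw [norm_sq_eq_integral, ← integral_indicator measurableSet_ball.compl]
  refine integral_congr_ae ?_
  filter_upwards [cutoff_ae R g, Lp.coeFn_sub g (cutoff R g)] with k h1 h2
  rw [h2, Pi.sub_apply, h1]
  by_cases hk : k ∈ Metric.ball (0 : EuclideanSpace ℝ (Fin N)) R <;> simp [hk]

theorem memLp_planeWave (R : ℝ) (x : EuclideanSpace ℝ (Fin N)) :
    MemLp ((Metric.ball (0 : EuclideanSpace ℝ (Fin N)) R).indicator
      fun k => (Real.fourierChar (-inner ℝ k x) : ℂ)) 2 volume := by
  have hc : Continuous fun k : EuclideanSpace ℝ (Fin N) =>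
      (Real.fourierChar (-inner ℝ k x) : ℂ) := by
    have := Real.continuous_fourierChar
    fun_prop
  refine MemLp.mono
    (memLp_indicator_const (E := ℂ) 2 (measurableSet_ball (x := 0) (ε := R)) 1
      (Or.inr measure_ball_lt_top.ne)) (hc.aestronglyMeasurable.indicator measurableSet_ball)
    (Eventually.of_forall fun k => ?_)
  by_cases hk : k ∈ Metric.ball (0 : EuclideanSpace ℝ (Fin N)) R <;>
    simp [hk, Circle.norm_coe]

/-- The conjugate plane wave of position `x`, truncated to the frequencies `‖k‖ < R`. -/
noncomputable def planeWave (R : ℝ) (x : EuclideanSpace ℝ (Fin N)) : L2C N :=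
  (memLp_planeWave R x).toLp _

theorem norm_planeWave_sq (R : ℝ) (x : EuclideanSpace ℝ (Fin N)) :
    ‖planeWave R x‖ ^ 2 = volume.real (Metric.ball (0 : EuclideanSpace ℝ (Fin N)) R) := by
  rw [norm_sq_eq_integral]
  have h : (fun k => ‖planeWave R x k‖ ^ 2) =ᵐ[volume]
      (Metric.ball (0 : EuclideanSpace ℝ (Fin N)) R).indicator fun _ => (1 : ℝ) := by
    filter_upwards [(memLp_planeWave R x).coeFn_toLp] with k hk
    rw [planeWave, hk]
    by_cases hk : k ∈ Metric.ball (0 : EuclideanSpace ℝ (Fin N)) R <;>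
      simp [hk, Circle.norm_coe]
  rw [integral_congr_ae h, integral_indicator measurableSet_ball]
  simp

/-- A cutoff function is integrable because balls have finite measure, so its inversion is a genuine
integral. Values at points thereby become continuous functionals of `g`, and weak convergence on the
Fourier side yields pointwise convergence of low-frequency parts. -/
theorem fourierInv_cutoff_ae (R : ℝ) (g : L2C N) :
    ((𝓕⁻ (cutoff R g) : L2C N) : EuclideanSpace ℝ (Fin N) → ℂ) =ᵐ[volume]
      fun x => inner ℂ (planeWave R x) g := by
  have hint : Integrable ((Metric.ball (0 : EuclideanSpace ℝ (Fin N)) R).indicator g) := by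
    rw [integrable_indicator_iff measurableSet_ball]
    have : IsFiniteMeasure (volume.restrict (Metric.ball (0 : EuclideanSpace ℝ (Fin N)) R)) :=
      ⟨by simpa using measure_ball_lt_top⟩
    exact ((Lp.memLp g).restrict _).integrable (by norm_num)
  filter_upwards [fourierInv_Lp_ae_eq (cutoff R g) (hint.congr (cutoff_ae R g).symm)] with x hx
  rw [hx, Real.fourierInv_congr_ae (cutoff_ae R g), Real.fourierInv_eq, L2.inner_def]
  refine integral_congr_ae ?_
  filter_upwards [(memLp_planeWave R x).coeFn_toLp] with k hk
  rw [planeWave, hk]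
  by_cases hk : k ∈ Metric.ball (0 : EuclideanSpace ℝ (Fin N)) R
  · simp only [hk, Set.indicator_of_mem, RCLike.inner_apply, Circle.smul_def, smul_eq_mul]
    rw [← Circle.coe_inv_eq_conj, AddChar.map_neg_eq_inv, inv_inv, mul_comm]
  · simp [hk]

theorem norm_inner_planeWave_sq_le (R : ℝ) (x : EuclideanSpace ℝ (Fin N)) (g : L2C N) :
    ‖inner ℂ (planeWave R x) g‖ ^ 2
      ≤ volume.real (Metric.ball (0 : EuclideanSpace ℝ (Fin N)) R) * ‖g‖ ^ 2 := by
  rw [← norm_planeWave_sq R x, ← mul_pow]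
  exact pow_le_pow_left₀ (norm_nonneg _) (norm_inner_le_norm _ _) 2

theorem integrableOn_norm_inner_planeWave_sq (R : ℝ) (g : L2C N)
    (S : Set (EuclideanSpace ℝ (Fin N))) :
    IntegrableOn (fun x => ‖inner ℂ (planeWave R x) g‖ ^ 2) S volume := by
  refine Integrable.integrableOn ((integrable_norm_sq (𝓕⁻ (cutoff R g) : L2C N)).congr ?_)
  filter_upwards [fourierInv_cutoff_ae R g] with x hx
  rw [hx]

/-- Split `u` into low and high frequencies and use `(a + b)² ≤ 2a² + 2b²`; Plancherel bounds the
high part on all of space. -/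
theorem setIntegral_sq_le_low_add_high (u : L2R N) (S : Set (EuclideanSpace ℝ (Fin N)))
    (R : ℝ) :
    ∫ x in S, (u x) ^ 2 ≤ 2 * (∫ x in S, ‖inner ℂ (planeWave R x) (fourierReal u)‖ ^ 2)
      + 2 * ‖fourierReal u - cutoff R (fourierReal u)‖ ^ 2 := by
  set g := fourierReal u with hg
  set h : L2C N := 𝓕⁻ (g - cutoff R g) with hh
  have hdec : (fun x => (u x) ^ 2) ≤ᵐ[volume]
      fun x => 2 * ‖inner ℂ (planeWave R x) g‖ ^ 2 + 2 * ‖h x‖ ^ 2 := by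
    have e : (𝓕⁻ (cutoff R g) : L2C N) + h = Complex.ofRealCLM.compLp u := by
      rw [hh, fourierInv_sub, hg, fourierInv_fourierReal]
      abel
    have e' := Lp.coeFn_add (𝓕⁻ (cutoff R g) : L2C N) h
    rw [e] at e'
    filter_upwards [e', ae_ofReal u, fourierInv_cutoff_ae R g] with x h1 h2 h3
    rw [h2, Pi.add_apply, h3] at h1
    have h4 : (u x) ^ 2 = ‖((u x : ℝ) : ℂ)‖ ^ 2 := by simp
    rw [h4, h1]
    nlinarith [norm_add_le (inner ℂ (planeWave R x) g) (h x), sq_nonneg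
      (‖inner ℂ (planeWave R x) g‖ - ‖h x‖), norm_nonneg (inner ℂ (planeWave R x) g + h x),
      norm_nonneg (inner ℂ (planeWave R x) g), norm_nonneg (h x)]
  have hu2 : Integrable (fun x => (u x) ^ 2) volume := by simpa using integrable_norm_sq u
  have i1 := (integrableOn_norm_inner_planeWave_sq R g S).const_mul 2
  have i2 := ((integrable_norm_sq h).integrableOn (s := S)).const_mul 2
  calc ∫ x in S, (u x) ^ 2
      ≤ ∫ x in S, (2 * ‖inner ℂ (planeWave R x) g‖ ^ 2 + 2 * ‖h x‖ ^ 2) :=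
        integral_mono_ae hu2.integrableOn (i1.add i2) (ae_restrict_of_ae hdec)
    _ = 2 * (∫ x in S, ‖inner ℂ (planeWave R x) g‖ ^ 2) + 2 * ∫ x in S, ‖h x‖ ^ 2 := by
        rw [integral_add i1 i2, integral_const_mul, integral_const_mul]
    _ ≤ _ := by
        have := setIntegral_norm_sq_le h S
        rw [hh, norm_fourierInv, ← hh] at this
        linarith

end FracSchrodinger

/-! ### The fractional Laplacian on the Fourier side -/

namespace FracSchrodinger

variable {N : ℕ} {s : ℝ}

theorem fourierReal_smul (c : ℝ) (u : L2R N) :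
    fourierReal (c • u) = (c : ℂ) • fourierReal u := by
  have h : (Complex.ofRealCLM.compLp (c • u) : L2C N)
      = (c : ℂ) • Complex.ofRealCLM.compLp u := by
    ext1
    filter_upwards [ae_ofReal (c • u), ae_ofReal u, Lp.coeFn_smul c u,
      Lp.coeFn_smul (c : ℂ) (Complex.ofRealCLM.compLp u : L2C N)] with x h1 h2 h3 h4
    rw [h1, h3, h4, Pi.smul_apply, Pi.smul_apply, h2]
    simp
  rw [fourierReal, h]
  exact (Lp.fourierTransformₗᵢ (EuclideanSpace ℝ (Fin N)) ℂ).map_smul _ _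

theorem fracSymbolMul_sub_ae (σ : ℝ) (u v : L2R N) :
    fracSymbolMul σ (u - v) =ᵐ[volume] fracSymbolMul σ u - fracSymbolMul σ v := by
  have h := Lp.coeFn_sub (fourierReal u) (fourierReal v)
  rw [← fourierReal_sub] at h
  filter_upwards [h] with k hk
  simp only [fracSymbolMul, hk, Pi.sub_apply]
  ring

theorem fracSymbolMul_smul_ae (σ c : ℝ) (u : L2R N) :
    fracSymbolMul σ (c • u) =ᵐ[volume] (c : ℂ) • fracSymbolMul σ u := by
  have h := Lp.coeFn_smul (c : ℂ) (fourierReal u)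
  rw [← fourierReal_smul] at h
  filter_upwards [h] with k hk
  simp only [fracSymbolMul, hk, Pi.smul_apply, smul_eq_mul]
  ring

theorem aestronglyMeasurable_fracSymbolMul (σ : ℝ) (u : L2R N) :
    AEStronglyMeasurable (fracSymbolMul σ u) volume := by
  refine AEStronglyMeasurable.mul ?_ (Lp.aestronglyMeasurable _)
  have : Measurable fun k : EuclideanSpace ℝ (Fin N) =>
      (((2 * Real.pi * ‖k‖) ^ (2 * σ) : ℝ) : ℂ) := by fun_prop
  exact this.aestronglyMeasurable

theorem MemHs.sub {u v : L2R N} (hu : MemHs s u) (hv : MemHs s v) : MemHs s (u - v) :=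
  (memLp_congr_ae (fracSymbolMul_sub_ae (s / 2) u v)).2 (MemLp.sub hu hv)

theorem MemHs.smul {u : L2R N} (c : ℝ) (hu : MemHs s u) : MemHs s (c • u) :=
  (memLp_congr_ae (fracSymbolMul_smul_ae (s / 2) c u)).2 (MemLp.const_smul hu (c : ℂ))

theorem MemHs.fourier_fracLaplacian {u : L2R N} (hu : MemHs s u) :
    (𝓕 (fracLaplacian (s / 2) u) : L2C N)
      = MemLp.toLp _ (show MemLp (fracSymbolMul (s / 2) u) 2 volume from hu) := by
  have h : MemLp (fracSymbolMul (s / 2) u) 2 volume := hu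
  rw [fracLaplacian, dif_pos h]
  exact FourierTransform.fourier_fourierInv_eq _

theorem MemHs.fourier_fracLaplacian_ae {u : L2R N} (hu : MemHs s u) :
    ((𝓕 (fracLaplacian (s / 2) u) : L2C N) : EuclideanSpace ℝ (Fin N) → ℂ)
      =ᵐ[volume] fracSymbolMul (s / 2) u := by
  rw [hu.fourier_fracLaplacian]
  exact MemLp.coeFn_toLp _

theorem MemHs.eLpNorm_fracSymbolMul {u : L2R N} (hu : MemHs s u) :
    eLpNorm (fracSymbolMul (s / 2) u) 2 volume = ENNReal.ofReal ‖fracLaplacian (s / 2) u‖ := by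
  rw [← Lp.norm_fourier_eq, hu.fourier_fracLaplacian, Lp.norm_toLp,
    ENNReal.ofReal_toReal (MemLp.eLpNorm_ne_top hu)]

theorem fourier_injective : Function.Injective (𝓕 : L2C N → L2C N) :=
  (Lp.fourierTransformₗᵢ (EuclideanSpace ℝ (Fin N)) ℂ).injective

theorem fourier_sub (g h : L2C N) : (𝓕 (g - h) : L2C N) = 𝓕 g - 𝓕 h :=
  (Lp.fourierTransformₗᵢ (EuclideanSpace ℝ (Fin N)) ℂ).map_sub g h

theorem MemHs.fracLaplacian_sub {u v : L2R N} (hu : MemHs s u) (hv : MemHs s v) :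
    fracLaplacian (s / 2) (u - v) = fracLaplacian (s / 2) u - fracLaplacian (s / 2) v := by
  apply fourier_injective
  rw [fourier_sub]
  ext1
  filter_upwards [hu.fourier_fracLaplacian_ae, hv.fourier_fracLaplacian_ae,
    (hu.sub hv).fourier_fracLaplacian_ae, fracSymbolMul_sub_ae (s / 2) u v,
    Lp.coeFn_sub (𝓕 (fracLaplacian (s / 2) u) : L2C N) (𝓕 (fracLaplacian (s / 2) v))]
    with k h1 h2 h3 h4 h5
  rw [h3, h5, h4, Pi.sub_apply, Pi.sub_apply, h1, h2]

theorem MemHs.norm_fracLaplacian_smul {u : L2R N} (c : ℝ) (hu : MemHs s u) :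
    ‖fracLaplacian (s / 2) (c • u)‖ = |c| * ‖fracLaplacian (s / 2) u‖ := by
  rw [← ENNReal.toReal_ofReal (norm_nonneg (fracLaplacian (s / 2) (c • u))),
    ← (hu.smul c).eLpNorm_fracSymbolMul, eLpNorm_congr_ae (fracSymbolMul_smul_ae (s / 2) c u),
    eLpNorm_const_smul, hu.eLpNorm_fracSymbolMul, ENNReal.toReal_mul,
    ENNReal.toReal_ofReal (norm_nonneg _)]
  simp

theorem hsForm_self (u : L2R N) : hsForm s u u = ‖fracLaplacian (s / 2) u‖ ^ 2 :=
  inner_self_eq_norm_sq (𝕜 := ℂ) _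

theorem MemHs.hsForm_sub_left {u v : L2R N} (hu : MemHs s u) (hv : MemHs s v) (w : L2R N) :
    hsForm s (u - v) w = hsForm s u w - hsForm s v w := by
  simp [hsForm, hu.fracLaplacian_sub hv, inner_sub_left]

theorem abs_hsForm_le (u v : L2R N) :
    |hsForm s u v| ≤ ‖fracLaplacian (s / 2) u‖ * ‖fracLaplacian (s / 2) v‖ :=
  (Complex.abs_re_le_norm _).trans (norm_inner_le_norm _ _)

/-- Chebyshev on the Fourier side: the symbol is at least `(2πR)^s` off the ball. -/
theorem MemHs.rpow_mul_norm_sub_cutoff_sq_le {u : L2R N} (hu : MemHs s u) (hs : 0 ≤ s)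
    {R : ℝ} (hR : 0 ≤ R) :
    (2 * Real.pi * R) ^ (2 * s) * ‖fourierReal u - cutoff R (fourierReal u)‖ ^ 2
      ≤ ‖fracLaplacian (s / 2) u‖ ^ 2 := by
  rw [norm_sub_cutoff_sq, ← integral_const_mul, ← Lp.norm_fourier_eq]
  refine le_trans ?_ (setIntegral_norm_sq_le _ (Metric.ball 0 R)ᶜ)
  refine setIntegral_mono_on_ae ((integrable_norm_sq _).integrableOn.const_mul _)
    (integrable_norm_sq _).integrableOn measurableSet_ball.compl ?_
  filter_upwards [hu.fourier_fracLaplacian_ae] with k hk hkR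
  have hkR' : R ≤ ‖k‖ := by simpa using hkR
  have h0 : (0 : ℝ) ≤ 2 * Real.pi * R := by positivity
  have hle : (2 * Real.pi * R) ^ s ≤ (2 * Real.pi * ‖k‖) ^ s :=
    Real.rpow_le_rpow h0 (by gcongr) hs
  have e : (2 * Real.pi * R) ^ (2 * s) = ((2 * Real.pi * R) ^ s) ^ 2 := by
    rw [mul_comm 2 s, Real.rpow_mul h0]
    norm_cast
  rw [hk, fracSymbolMul, norm_mul, mul_pow, e, show 2 * (s / 2) = s by ring,
    Complex.norm_real, Real.norm_of_nonneg (by positivity)]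
  gcongr

/-- A Bernstein inequality: on low frequencies the symbol is bounded, so the `L²` norm alone
suffices. For `R ≤ 0` the ball is empty. -/
theorem MemHs.norm_cutoff_fourier_fracLaplacian_sq_le {u : L2R N} (hu : MemHs s u) (hs : 0 ≤ s)
    (R : ℝ) :
    ‖cutoff R (𝓕 (fracLaplacian (s / 2) u))‖ ^ 2
      ≤ (((2 * Real.pi * R) ^ s) ^ 2) * ‖u‖ ^ 2 := by
  rw [← norm_fourierReal, norm_sq_eq_integral, norm_sq_eq_integral, ← integral_const_mul]
  refine integral_mono_ae (integrable_norm_sq _) ((integrable_norm_sq _).const_mul _) ?_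
  filter_upwards [cutoff_ae R (𝓕 (fracLaplacian (s / 2) u)), hu.fourier_fracLaplacian_ae]
    with k h1 h2
  rw [h1]
  by_cases hk : k ∈ Metric.ball (0 : EuclideanSpace ℝ (Fin N)) R
  · rw [Set.indicator_of_mem hk, h2, fracSymbolMul, norm_mul, mul_pow,
      show 2 * (s / 2) = s by ring, Complex.norm_real, Real.norm_of_nonneg (by positivity)]
    have hk' : ‖k‖ ≤ R := by simpa using (mem_ball_zero_iff.1 hk).le
    gcongr
  · rw [Set.indicator_of_notMem hk]
    simpa using by positivity

theorem inner_cutoff (R : ℝ) (g h : L2C N) :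
    inner ℂ (cutoff R g) h = inner ℂ g (cutoff R h) := by
  rw [L2.inner_def, L2.inner_def]
  refine integral_congr_ae ?_
  filter_upwards [cutoff_ae R g, cutoff_ae R h] with k h1 h2
  rw [h1, h2]
  by_cases hk : k ∈ Metric.ball (0 : EuclideanSpace ℝ (Fin N)) R <;> simp [hk]

theorem exists_norm_sub_cutoff_lt (g : L2C N) {ε : ℝ} (hε : 0 < ε) :
    ∃ R : ℝ, ‖g - cutoff R g‖ < ε := by
  have h := tendsto_setIntegral_of_antitone
    (s := fun n : ℕ => (Metric.ball (0 : EuclideanSpace ℝ (Fin N)) n)ᶜ)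
    (fun n => measurableSet_ball.compl)
    (fun m n hmn => Set.compl_subset_compl.2 (Metric.ball_subset_ball (by exact_mod_cast hmn)))
    ⟨0, (integrable_norm_sq g).integrableOn⟩
  have he : (⋂ n : ℕ, (Metric.ball (0 : EuclideanSpace ℝ (Fin N)) n)ᶜ) = ∅ := by
    rw [← Set.compl_iUnion, Metric.iUnion_ball_nat, Set.compl_univ]
  rw [he, setIntegral_empty] at h
  obtain ⟨n, hn⟩ := (h.eventually (gt_mem_nhds (sq_pos_of_pos hε))).exists
  refine ⟨n, ?_⟩
  rw [← norm_sub_cutoff_sq] at hn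
  exact lt_of_pow_lt_pow_left₀ 2 hε.le hn

/-- Lower semicontinuity by Fatou: the Fourier transforms converge almost everywhere along a
subsequence, and so do their products with the symbol. -/
theorem memHs_of_tendsto {u : ℕ → L2R N} {u₀ : L2R N} {K : ℝ} (hu : ∀ n, MemHs s (u n))
    (hK : ∀ n, ‖fracLaplacian (s / 2) (u n)‖ ≤ K) (hlim : Tendsto u atTop (𝓝 u₀)) :
    MemHs s u₀ := by
  have hlim' : Tendsto (fun n => fourierReal (u n)) atTop (𝓝 (fourierReal u₀)) := by
    rw [tendsto_iff_norm_sub_tendsto_zero] at hlim ⊢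
    simpa only [← fourierReal_sub, norm_fourierReal] using hlim
  obtain ⟨θ, -, hθ⟩ := (tendstoInMeasure_of_tendsto_Lp hlim').exists_seq_tendsto_ae
  refine ⟨aestronglyMeasurable_fracSymbolMul _ _, ?_⟩
  refine lt_of_le_of_lt (Lp.eLpNorm_lim_le_liminf_eLpNorm
    (fun n => aestronglyMeasurable_fracSymbolMul (s / 2) (u (θ n))) _ ?_)
    (lt_of_le_of_lt ?_ (ENNReal.ofReal_lt_top (r := K)))
  · filter_upwards [hθ] with k hk
    exact hk.const_mul _
  · refine liminf_le_of_le (by isBoundedDefault) fun b hb => ?_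
    obtain ⟨n, hn⟩ := hb.exists
    rw [(hu _).eLpNorm_fracSymbolMul] at hn
    exact hn.trans (ENNReal.ofReal_le_ofReal (hK _))

/-- Strong `L²` convergence plus a seminorm bound gives weak convergence of the half Laplacians.
High frequencies of the fixed `v` are small; on low ones the cutoff is moved onto `u n`, where
Bernstein applies. -/
theorem tendsto_hsForm_of_tendsto {u : ℕ → L2R N} {v : L2R N} {K : ℝ} (hs : 0 ≤ s)
    (hu : ∀ n, MemHs s (u n)) (hK : ∀ n, ‖fracLaplacian (s / 2) (u n)‖ ≤ K)
    (hlim : Tendsto u atTop (𝓝 0)) :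
    Tendsto (fun n => hsForm s v (u n)) atTop (𝓝 0) := by
  set g : L2C N := 𝓕 (fracLaplacian (s / 2) v) with hg
  have hK0 : 0 ≤ K := (norm_nonneg _).trans (hK 0)
  rw [Metric.tendsto_atTop]
  intro ε hε
  obtain ⟨R, hR⟩ := exists_norm_sub_cutoff_lt g (ε := ε / (2 * (K + 1))) (by positivity)
  -- The absolute value is there because no sign of `R` is known.
  set M := |(2 * Real.pi * R) ^ s| with hM
  have hlim0 : Tendsto (fun n => ‖g‖ * (M * ‖u n‖)) atTop (𝓝 0) := by
    simpa using (hlim.norm.const_mul M).const_mul ‖g‖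
  obtain ⟨n₀, hn₀⟩ := eventually_atTop.1 (hlim0.eventually (gt_mem_nhds (half_pos hε)))
  refine ⟨n₀, fun n hn => ?_⟩
  set h : L2C N := 𝓕 (fracLaplacian (s / 2) (u n)) with hh
  have hform : hsForm s v (u n) = (inner ℂ g h).re := by
    rw [hg, hh, Lp.inner_fourier_eq, hsForm]
  have hdec : inner ℂ g h = inner ℂ (g - cutoff R g) h + inner ℂ g (cutoff R h) := by
    rw [inner_sub_left, inner_cutoff]
    ring
  have hhK : ‖h‖ ≤ K := by
    rw [hh, Lp.norm_fourier_eq]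
    exact hK n
  have hcut : ‖cutoff R h‖ ≤ M * ‖u n‖ := by
    have := (hu n).norm_cutoff_fourier_fracLaplacian_sq_le hs R
    rw [← mul_pow] at this
    rw [hM, ← abs_of_nonneg (norm_nonneg (u n)), ← abs_mul]
    exact (Real.sqrt_sq (norm_nonneg _)).symm.le.trans
      ((Real.sqrt_le_sqrt this).trans (Real.sqrt_sq_eq_abs _).le)
  have h1 : ‖inner ℂ (g - cutoff R g) h‖ < ε / 2 := by
    calc ‖inner ℂ (g - cutoff R g) h‖ ≤ ‖g - cutoff R g‖ * ‖h‖ := norm_inner_le_norm _ _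
      _ ≤ ε / (2 * (K + 1)) * K := by gcongr
      _ < ε / 2 := by
        rw [div_mul_eq_mul_div, div_lt_div_iff₀ (by positivity) (by positivity)]
        nlinarith
  have h2 : ‖inner ℂ g (cutoff R h)‖ < ε / 2 :=
    (norm_inner_le_norm _ _).trans_lt
      ((mul_le_mul_of_nonneg_left hcut (norm_nonneg _)).trans_lt (hn₀ n hn))
  rw [Real.dist_eq, sub_zero, hform]
  refine (Complex.abs_re_le_norm _).trans_lt ?_
  rw [hdec]
  exact (norm_add_le _ _).trans_lt (by linarith)

end FracSchrodinger

/-! ### Weak compactness, smallness on small sets, coercivity and local Rellich -/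

namespace FracSchrodinger

section WeakCompactness

variable {H : Type*} [NormedAddCommGroup H] [InnerProductSpace ℂ H] [CompleteSpace H]
  [TopologicalSpace.SeparableSpace H]

/-- A bounded sequence in a separable Hilbert space has a weakly convergent subsequence. -/
theorem exists_subseq_tendsto_inner {g : ℕ → H} {K : ℝ} (hg : ∀ n, ‖g n‖ ≤ K) :
    ∃ θ : ℕ → ℕ, StrictMono θ ∧ ∃ g₀ : H, ∀ w : H,
      Tendsto (fun n => inner ℂ w (g (θ n))) atTop (𝓝 (inner ℂ w g₀)) := by
  set ℓ : ℕ → WeakDual ℂ H := fun n =>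
    StrongDual.toWeakDual (InnerProductSpace.toDual ℂ H (g n)) with hℓ
  obtain ⟨a, -, θ, hθ, hlim⟩ := WeakDual.isSeqCompact_closedBall ℂ H 0 K (x := ℓ) (fun n => by
    simpa [hℓ] using hg n)
  refine ⟨θ, hθ, (InnerProductSpace.toDual ℂ H).symm (WeakDual.toStrongDual a), fun w => ?_⟩
  have h1 : Tendsto (fun n => ℓ (θ n) w) atTop (𝓝 (a w)) :=
    ((WeakDual.eval_continuous w).tendsto a).comp hlim
  -- The functional attached to `g` is `w ↦ ⟨g, w⟩`; conjugation puts `w` in the first slot.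
  have h2 := (RCLike.continuous_conj (K := ℂ)).continuousAt.tendsto.comp h1
  convert! h2 using 2
  · simp [hℓ]
  · rw [← inner_conj_symm, InnerProductSpace.toDual_symm_apply]
    rfl

end WeakCompactness

variable {N : ℕ} {s : ℝ}

theorem setIntegral_inner_planeWave_sq_le (R : ℝ) (g : L2C N)
    {S : Set (EuclideanSpace ℝ (Fin N))} (hS : volume S ≠ ⊤) :
    ∫ x in S, ‖inner ℂ (planeWave R x) g‖ ^ 2
      ≤ volume.real (Metric.ball (0 : EuclideanSpace ℝ (Fin N)) R) * volume.real S * ‖g‖ ^ 2 := by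
  have hfin : IsFiniteMeasure (volume.restrict S) := ⟨by simpa using hS.lt_top⟩
  calc ∫ x in S, ‖inner ℂ (planeWave R x) g‖ ^ 2
      ≤ ∫ _ in S, volume.real (Metric.ball (0 : EuclideanSpace ℝ (Fin N)) R) * ‖g‖ ^ 2 :=
        integral_mono_of_nonneg (Eventually.of_forall fun x => by positivity)
          (integrable_const _) (Eventually.of_forall fun x => norm_inner_planeWave_sq_le R x g)
    _ = _ := by
        rw [setIntegral_const, smul_eq_mul]
        ring

theorem MemHs.two_mul_norm_sub_cutoff_sq_le {u : L2R N} (hu : MemHs s u) (hs : 0 ≤ s)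
    {R : ℝ} (hR : 0 < R) :
    2 * ‖fourierReal u - cutoff R (fourierReal u)‖ ^ 2
      ≤ 2 / (2 * Real.pi * R) ^ (2 * s) * ‖fracLaplacian (s / 2) u‖ ^ 2 := by
  have h := hu.rpow_mul_norm_sub_cutoff_sq_le hs hR.le
  have hpos : 0 < (2 * Real.pi * R) ^ (2 * s) := by positivity
  rw [div_mul_eq_mul_div, le_div_iff₀ hpos]
  linarith

/-- The radius is free and serves both ways: large `R` shrinks the seminorm term, small `R` shrinks
the `‖u‖²` term. -/
theorem MemHs.setIntegral_sq_le {u : L2R N} (hu : MemHs s u) (hs : 0 ≤ s)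
    {R : ℝ} (hR : 0 < R) {S : Set (EuclideanSpace ℝ (Fin N))} (hS : volume S ≠ ⊤) :
    ∫ x in S, (u x) ^ 2
      ≤ 2 * (volume.real (Metric.ball (0 : EuclideanSpace ℝ (Fin N)) R) * volume.real S)
          * ‖u‖ ^ 2
        + 2 / (2 * Real.pi * R) ^ (2 * s) * ‖fracLaplacian (s / 2) u‖ ^ 2 := by
  have h1 := setIntegral_sq_le_low_add_high u S R
  have h2 := setIntegral_inner_planeWave_sq_le R (fourierReal u) hS
  have h3 := hu.two_mul_norm_sub_cutoff_sq_le hs hR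
  rw [norm_fourierReal] at h2
  linarith

theorem exists_pos_two_div_rpow_mul_lt (hs : 0 < s) (A : ℝ) {ε : ℝ} (hε : 0 < ε) :
    ∃ R : ℝ, 0 < R ∧ 2 / (2 * Real.pi * R) ^ (2 * s) * A < ε := by
  have h1 : Tendsto (fun R : ℝ => (2 * Real.pi * R) ^ (2 * s)) atTop atTop :=
    (tendsto_rpow_atTop (by positivity)).comp
      (tendsto_id.const_mul_atTop (by positivity))
  have h2 : Tendsto (fun R : ℝ => 2 / (2 * Real.pi * R) ^ (2 * s) * A) atTop (𝓝 0) := by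
    simpa using (h1.const_div_atTop 2).mul_const A
  obtain ⟨R, hR, hR0⟩ := ((h2.eventually (gt_mem_nhds hε)).and (eventually_gt_atTop 0)).exists
  exact ⟨R, hR0, hR⟩

/-- On sets of small measure, the `L²` mass of functions bounded in `H^s` is uniformly small. -/
theorem exists_setIntegral_sq_lt (hs : 0 < s) (K : ℝ) {ε : ℝ} (hε : 0 < ε) :
    ∃ d : ℝ, 0 < d ∧ ∀ (S : Set (EuclideanSpace ℝ (Fin N))), volume S ≠ ⊤ → volume.real S < d →
      ∀ u : L2R N, MemHs s u → ‖u‖ ≤ K → ‖fracLaplacian (s / 2) u‖ ≤ K →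
        ∫ x in S, (u x) ^ 2 < ε := by
  -- `R` is fixed first to tame the high frequencies; the admissible measure of `S` then depends on
  -- the volume of that ball.
  obtain ⟨R, hR, hRε⟩ := exists_pos_two_div_rpow_mul_lt hs (K ^ 2) (half_pos hε)
  set m := volume.real (Metric.ball (0 : EuclideanSpace ℝ (Fin N)) R) with hm
  have hm0 : 0 ≤ m := measureReal_nonneg
  refine ⟨ε / (4 * (m * K ^ 2 + 1)), by positivity, fun S hS hSd u hu huK huK' => ?_⟩
  refine (hu.setIntegral_sq_le hs.le hR hS).trans_lt ?_
  rw [← hm]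
  have hK : ‖u‖ ^ 2 ≤ K ^ 2 := pow_le_pow_left₀ (norm_nonneg _) huK 2
  have hK' : ‖fracLaplacian (s / 2) u‖ ^ 2 ≤ K ^ 2 := pow_le_pow_left₀ (norm_nonneg _) huK' 2
  have h1 : 2 / (2 * Real.pi * R) ^ (2 * s) * ‖fracLaplacian (s / 2) u‖ ^ 2 < ε / 2 :=
    (mul_le_mul_of_nonneg_left hK' (by positivity)).trans_lt hRε
  have h2 : 2 * (m * volume.real S) * ‖u‖ ^ 2 ≤ ε / 2 := by
    rw [lt_div_iff₀ (by positivity)] at hSd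
    have hS0 : 0 ≤ volume.real S := measureReal_nonneg
    have h3 : 2 * (m * volume.real S) * ‖u‖ ^ 2 ≤ 2 * (m * volume.real S) * K ^ 2 := by gcongr
    nlinarith
  linarith

/-- Volume scales like `R^N`. In dimension `0` every ball is a point of mass one, whence `1 ≤ N`. -/
theorem exists_pos_volume_ball_mul_lt (hN : 1 ≤ N) (M : ℝ) {ε : ℝ} (hε : 0 < ε) :
    ∃ R : ℝ, 0 < R ∧
      volume.real (Metric.ball (0 : EuclideanSpace ℝ (Fin N)) R) * M < ε := by
  have h : Tendsto (fun R : ℝ => R ^ N *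
      volume.real (Metric.ball (0 : EuclideanSpace ℝ (Fin N)) 1) * M) (𝓝[>] 0) (𝓝 0) := by
    have hc : Continuous (fun R : ℝ => R ^ N *
      volume.real (Metric.ball (0 : EuclideanSpace ℝ (Fin N)) 1) * M) := by fun_prop
    have := hc.tendsto 0
    rw [zero_pow (by omega), zero_mul, zero_mul] at this
    exact this.mono_left nhdsWithin_le_nhds
  obtain ⟨R, hR, hR0⟩ := ((h.eventually (gt_mem_nhds hε)).and self_mem_nhdsWithin).exists
  refine ⟨R, hR0, ?_⟩
  rwa [Measure.real, Measure.addHaar_ball_of_pos _ _ hR0, ENNReal.toReal_mul,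
    ENNReal.toReal_ofReal (pow_nonneg (le_of_lt hR0) _), finrank_euclideanSpace_fin]

/-- Chebyshev's inequality for the weighted `L²` mass. -/
theorem setIntegral_sq_le_one_div_mul {V : EuclideanSpace ℝ (Fin N) → ℝ} (hV0 : ∀ x, 0 ≤ V x)
    {u : L2R N} (hu : Integrable (fun x => V x * u x ^ 2) volume) {c : ℝ} (hc : 0 < c)
    {T : Set (EuclideanSpace ℝ (Fin N))} (hT : MeasurableSet T) (hcT : ∀ x ∈ T, c ≤ V x) :
    ∫ x in T, (u x) ^ 2 ≤ 1 / c * ∫ x, V x * u x ^ 2 := by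
  have hu2 : Integrable (fun x => (u x) ^ 2) volume := by simpa using integrable_norm_sq u
  rw [← integral_const_mul]
  refine (setIntegral_mono_on hu2.integrableOn (hu.integrableOn.const_mul _)
    hT fun x hx => ?_).trans (setIntegral_le_integral (hu.const_mul _)
      (Eventually.of_forall fun x => ?_))
  · rw [← mul_assoc, one_div_mul_eq_div]
    exact le_mul_of_one_le_left (by positivity) ((one_le_div hc).2 (hcT x hx))
  · have := hV0 x
    simp only [Pi.zero_apply]
    positivity

/-- If `V` is bounded below by a positive constant outside a set of finite measure, the energy
space embeds into `L²`. -/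
theorem exists_norm_sq_le (hN : 1 ≤ N) (hs : 0 ≤ s) {V : EuclideanSpace ℝ (Fin N) → ℝ}
    (hV : Continuous V) (hV0 : ∀ x, 0 ≤ V x) {b : ℝ} (hb : 0 < b)
    (hVb : volume {x | V x < b} < ⊤) :
    ∃ C : ℝ, 0 < C ∧ ∀ u : L2R N, MemEnergySpace s V u →
      ‖u‖ ^ 2 ≤ C * (‖fracLaplacian (s / 2) u‖ ^ 2 + ∫ x, V x * u x ^ 2) := by
  -- With `1 / 4` the low-frequency term is at most half of `‖u‖²` and is absorbed on the left,
  -- which produces the factor `2` in the final constant.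
  obtain ⟨R, hR, hRM⟩ := exists_pos_volume_ball_mul_lt hN (volume.real {x | V x < b})
    (ε := 1 / 4) (by norm_num)
  set c := 2 / (2 * Real.pi * R) ^ (2 * s) with hc
  have hc0 : 0 < c := by positivity
  refine ⟨2 * (c + 1 / b), by positivity, fun u hu => ?_⟩
  have hmeas : MeasurableSet {x | V x < b} := (isOpen_lt hV continuous_const).measurableSet
  have hu2 : Integrable (fun x => (u x) ^ 2) volume := by simpa using integrable_norm_sq u
  have h1 : ∫ x in {x | V x < b}, (u x) ^ 2
      ≤ 1 / 2 * ‖u‖ ^ 2 + c * ‖fracLaplacian (s / 2) u‖ ^ 2 := by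
    refine (hu.1.setIntegral_sq_le hs hR hVb.ne).trans ?_
    have : 0 ≤ ‖u‖ ^ 2 := by positivity
    nlinarith
  have h2 : ∫ x in {x | V x < b}ᶜ, (u x) ^ 2 ≤ 1 / b * ∫ x, V x * u x ^ 2 :=
    setIntegral_sq_le_one_div_mul hV0 hu.2 hb hmeas.compl fun x hx => by simpa using hx
  have h3 : ‖u‖ ^ 2 = (∫ x in {x | V x < b}, (u x) ^ 2) + ∫ x in {x | V x < b}ᶜ, (u x) ^ 2 := by
    rw [integral_add_compl hmeas hu2, norm_sq_eq_integral]
    simp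
  have h4 : 0 ≤ ∫ x, V x * u x ^ 2 := integral_nonneg fun x => by
    have := hV0 x
    positivity
  have h5 : 0 ≤ 1 / b * ‖fracLaplacian (s / 2) u‖ ^ 2 := by positivity
  nlinarith [mul_nonneg hc0.le h4]

theorem fact_two_ne_top : Fact ((2 : ENNReal) ≠ ⊤) := ⟨by norm_num⟩

/-- Local Rellich compactness: a sequence bounded in `H^s` has a subsequence which is Cauchy in
`L²(S)` for a given set `S` of finite measure. -/
theorem exists_subseq_setIntegral_sq_tendsto (hs : 0 < s) {u : ℕ → L2R N} {K : ℝ}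
    (hu : ∀ n, MemHs s (u n)) (hK : ∀ n, ‖u n‖ ≤ K)
    (hK' : ∀ n, ‖fracLaplacian (s / 2) (u n)‖ ≤ K)
    {S : Set (EuclideanSpace ℝ (Fin N))} (hS : volume S ≠ ⊤) :
    ∃ θ : ℕ → ℕ, StrictMono θ ∧
      Tendsto (fun q : ℕ × ℕ => ∫ x in S, ((u (θ q.1) - u (θ q.2) : L2R N) x) ^ 2)
        atTop (𝓝 0) := by
  have := fact_two_ne_top
  have : SecondCountableTopology (L2C N) := Lp.SecondCountableTopology
  have hfin : IsFiniteMeasure (volume.restrict S) := ⟨by simpa using hS.lt_top⟩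
  obtain ⟨θ, hθ, g₀, hg₀⟩ := exists_subseq_tendsto_inner (g := fun n => fourierReal (u n))
    (K := K) (fun n => by simpa [norm_fourierReal] using hK n)
  refine ⟨θ, hθ, ?_⟩
  -- At fixed `x` the pairing with a plane wave converges by weak convergence, with a bound uniform
  -- in `x`; dominated convergence applies because `S` has finite measure.
  have hlow : ∀ R : ℝ, Tendsto (fun q : ℕ × ℕ =>
      ∫ x in S, ‖inner ℂ (planeWave R x) (fourierReal (u (θ q.1) - u (θ q.2)))‖ ^ 2)
        atTop (𝓝 0) := by
    intro R
    have hbound : ∀ q : ℕ × ℕ, ‖fourierReal (u (θ q.1) - u (θ q.2))‖ ≤ K + K := fun q => by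
      rw [norm_fourierReal]
      exact (norm_sub_le _ _).trans (add_le_add (hK _) (hK _))
    have h := tendsto_integral_filter_of_dominated_convergence (μ := volume.restrict S)
      (l := (atTop : Filter (ℕ × ℕ)))
      (F := fun q x => ‖inner ℂ (planeWave R x) (fourierReal (u (θ q.1) - u (θ q.2)))‖ ^ 2)
      (f := fun _ => (0 : ℝ))
      (fun _ => volume.real (Metric.ball (0 : EuclideanSpace ℝ (Fin N)) R) * (K + K) ^ 2)
      (Eventually.of_forall fun q =>
        (integrableOn_norm_inner_planeWave_sq R _ S).aestronglyMeasurable)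
      (Eventually.of_forall fun q => Eventually.of_forall fun x => by
        rw [Real.norm_of_nonneg (by positivity)]
        refine (norm_inner_planeWave_sq_le R x _).trans ?_
        have := hbound q
        gcongr)
      (integrable_const _)
      (Eventually.of_forall fun x => by
        have h1 : Tendsto (fun q : ℕ × ℕ => inner ℂ (planeWave R x) (fourierReal (u (θ q.1)))
            - inner ℂ (planeWave R x) (fourierReal (u (θ q.2)))) atTop
            (𝓝 (inner ℂ (planeWave R x) g₀ - inner ℂ (planeWave R x) g₀)) := by
          rw [← prod_atTop_atTop_eq]
          exact ((hg₀ (planeWave R x)).comp tendsto_fst).sub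
            ((hg₀ (planeWave R x)).comp tendsto_snd)
        have h2 := (h1.norm).pow 2
        simpa only [fourierReal_sub, inner_sub_right, sub_self, norm_zero, ne_eq,
          OfNat.ofNat_ne_zero, not_false_eq_true, zero_pow] using h2)
    simpa using h
  rw [Metric.tendsto_nhds]
  intro ε hε
  obtain ⟨R, hR, hRε⟩ := exists_pos_two_div_rpow_mul_lt hs ((K + K) ^ 2) (half_pos hε)
  filter_upwards [(hlow R).eventually (gt_mem_nhds (show (0 : ℝ) < ε / 4 by positivity))] with q hq
  rw [Real.dist_eq, sub_zero, abs_of_nonneg (integral_nonneg fun x => by positivity)]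
  have h1 := setIntegral_sq_le_low_add_high (u (θ q.1) - u (θ q.2)) S R
  have h2 := ((hu (θ q.1)).sub (hu (θ q.2))).two_mul_norm_sub_cutoff_sq_le hs.le hR
  have h3 : ‖fracLaplacian (s / 2) (u (θ q.1) - u (θ q.2))‖ ^ 2 ≤ (K + K) ^ 2 := by
    rw [(hu (θ q.1)).fracLaplacian_sub (hu (θ q.2))]
    exact pow_le_pow_left₀ (norm_nonneg _)
      ((norm_sub_le _ _).trans (add_le_add (hK' _) (hK' _))) 2
  have h4 : 2 / (2 * Real.pi * R) ^ (2 * s)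
      * ‖fracLaplacian (s / 2) (u (θ q.1) - u (θ q.2))‖ ^ 2 < ε / 2 :=
    (mul_le_mul_of_nonneg_left h3 (by positivity)).trans_lt hRε
  linarith

end FracSchrodinger

/-! ### Null boundary, test functions and Hölder's inequality -/

namespace FracSchrodinger

section Boundary

variable {E : Type*} [NormedAddCommGroup E] [NormedSpace ℝ E] [FiniteDimensional ℝ E]
  [MeasurableSpace E] [BorelSpace E] (μ : Measure E) [μ.IsAddHaarMeasure]

/-- Near a regular point, the zero set of a strictly differentiable function is null. -/
theorem exists_nhds_measure_zeroSet_eq_zero {φ : E → ℝ} {L : E →L[ℝ] ℝ} {x : E}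
    (hφ : HasStrictFDerivAt φ L x) (hL : L ≠ 0) :
    ∃ W ∈ 𝓝 x, μ (W ∩ {y | φ y = 0}) = 0 := by
  obtain ⟨e, he⟩ : ∃ e, L e ≠ 0 := by
    by_contra! h
    exact hL (ContinuousLinearMap.ext h)
  -- straighten the zero set into the kernel of `L`
  set Φ : E → E := fun y => y + ((φ y - L y) / L e) • e with hΦ
  have hΦ' : HasStrictFDerivAt Φ (ContinuousLinearMap.id ℝ E) x := by
    have h := (hasStrictFDerivAt_id (𝕜 := ℝ) x).add
      (((hφ.sub L.hasStrictFDerivAt).mul_const (L e)⁻¹).smul_const e)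
    simpa [hΦ, div_eq_mul_inv] using! h
  -- Near `x` the map `Φ` is close to the identity, so it cannot shrink measure by more than a
  -- factor `1 / 2`. Since `L (Φ y) = φ y`, the zero set lands in the proper subspace `ker L`, which
  -- is null.
  obtain ⟨c, hc, hc0⟩ := ((mul_le_addHaar_image_of_lt_det μ (ContinuousLinearMap.id ℝ E)
    (m := 1 / 2) (by simp [ContinuousLinearMap.det])).and self_mem_nhdsWithin).exists
  obtain ⟨W, hW, hWc⟩ := hΦ'.approximates_deriv_on_nhds (c := c) (Or.inr hc0)
  refine ⟨W, hW, ?_⟩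
  have h1 := hc (W ∩ {y | φ y = 0}) Φ (hWc.mono_set Set.inter_subset_left)
  have h2 : μ (Φ '' (W ∩ {y | φ y = 0})) = 0 := by
    refine measure_mono_null ?_ (Measure.addHaar_submodule μ (LinearMap.ker L.toLinearMap) ?_)
    · rintro _ ⟨y, ⟨-, hy⟩, rfl⟩
      have hy' : φ y = 0 := hy
      simp [hΦ, hy', he]
    · intro h
      have : e ∈ LinearMap.ker L.toLinearMap := h ▸ Submodule.mem_top
      exact he this
  rw [h2] at h1
  simpa using h1

end Boundary

variable {N : ℕ}

/-- At a frontier point the local defining function is `≤ 0` as a limit from `Ω`, and not `< 0`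
because an open set misses its frontier. So the frontier lies locally in a regular zero set. -/
theorem HasSmoothBoundary.volume_frontier_eq_zero {Ω : Set (EuclideanSpace ℝ (Fin N))}
    (hΩ : HasSmoothBoundary Ω) (hopen : IsOpen Ω) : volume (frontier Ω) = 0 := by
  refine measure_null_of_locally_null _ fun x hx => ?_
  obtain ⟨U, hU, hxU, φ, hφ, hφ', hΩU⟩ := hΩ x hx
  have hstrict : HasStrictFDerivAt φ (fderiv ℝ φ x) x :=
    (hφ.contDiffAt (hU.mem_nhds hxU)).hasStrictFDerivAt (by simp)
  obtain ⟨W, hW, hWnull⟩ := exists_nhds_measure_zeroSet_eq_zero volume hstrict (hφ' x hxU)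
  refine ⟨W ∩ U ∩ frontier Ω, ?_, measure_mono_null ?_ hWnull⟩
  · rw [Set.inter_comm]
    exact inter_mem_nhdsWithin _ (inter_mem hW (hU.mem_nhds hxU))
  · rintro y ⟨⟨hyW, hyU⟩, hy⟩
    refine ⟨hyW, le_antisymm ?_ ?_⟩
    · have hcont : ContinuousAt φ y := hφ.continuousOn.continuousAt (hU.mem_nhds hyU)
      have hcl : y ∈ closure (Ω ∩ U) := by
        rw [Set.inter_comm]
        exact hU.inter_closure ⟨hyU, frontier_subset_closure hy⟩
      have hfreq : ∃ᶠ z in 𝓝 y, φ z ≤ 0 :=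
        (mem_closure_iff_frequently.1 hcl).mono fun z hz =>
          (hΩU ▸ hz : z ∈ {y | y ∈ U ∧ φ y < 0}).2.le
      exact le_of_tendsto_of_frequently hcont.tendsto hfreq
    · by_contra! h
      have : y ∈ Ω ∩ U := hΩU ▸ ⟨hyU, h⟩
      exact (hopen.frontier_eq ▸ hy).2 this.1

section TestFunction

/-- Test functions are in `H^s`. -/
theorem memHs_of_ae_eq {s : ℝ} (hs : 0 ≤ s) (hs1 : s ≤ 1)
    {w : EuclideanSpace ℝ (Fin N) → ℝ}
    (hw : ContDiff ℝ ∞ w) (hwc : HasCompactSupport w) {u : L2R N} (hu : u =ᵐ[volume] w) :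
    MemHs s u := by
  have hΦc : HasCompactSupport (fun x => (w x : ℂ)) := hwc.comp_left Complex.ofReal_zero
  have hΦ : ContDiff ℝ ∞ (fun x => (w x : ℂ)) := Complex.ofRealCLM.contDiff.comp hw
  let Φ : SchwartzMap (EuclideanSpace ℝ (Fin N)) ℂ := hΦc.toSchwartzMap hΦ
  have hΦu : (Complex.ofRealCLM.compLp u : L2C N) = Φ.toLp 2 := by
    ext1
    filter_upwards [ae_ofReal u, Φ.coeFn_toLp 2 volume, hu] with x h1 h2 h3
    rw [h1, h2, h3]
    rfl
  have hfour : fourierReal u = (𝓕 Φ).toLp 2 := by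
    rw [fourierReal, hΦu, SchwartzMap.toLp_fourier_eq]
  set Ψ := 𝓕 Φ with hΨ
  -- The sup bound on `Ψ` replaces one factor of `‖Ψ‖²`, leaving weighted first powers that Schwartz
  -- decay makes integrable.
  obtain ⟨M, -, hM⟩ := Ψ.decay 0 0
  simp only [pow_zero, one_mul, norm_iteratedFDeriv_zero] at hM
  have hbound : Integrable (fun k => 2 * M * (‖k‖ ^ 0 * ‖Ψ k‖)
      + 2 * (2 * Real.pi) ^ 2 * M * (‖k‖ ^ 2 * ‖Ψ k‖)) volume :=
    ((Ψ.integrable_pow_mul volume 0).const_mul _).add ((Ψ.integrable_pow_mul volume 2).const_mul _)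
  refine (memLp_two_iff_integrable_sq_norm (aestronglyMeasurable_fracSymbolMul (s / 2) u)).2
    (hbound.mono' ((aestronglyMeasurable_fracSymbolMul (s / 2) u).norm.pow 2) ?_)
  have hΨae := Ψ.coeFn_toLp 2 volume
  rw [← hfour] at hΨae
  filter_upwards [hΨae] with k hk
  set r := 2 * Real.pi * ‖k‖ with hr
  have hr0 : 0 ≤ r := by positivity
  have hrs : r ^ s ≤ 1 + r := by
    rcases le_total r 1 with h | h
    · exact (Real.rpow_le_one hr0 h hs).trans (by linarith)
    · exact (Real.rpow_le_rpow_of_exponent_le h hs1).trans (by rw [Real.rpow_one]; linarith)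
  rw [Real.norm_of_nonneg (by positivity), fracSymbolMul, hk, norm_mul, mul_pow, ← hr,
    show 2 * (s / 2) = s by ring, Complex.norm_real, Real.norm_of_nonneg (by positivity)]
  calc (r ^ s) ^ 2 * ‖Ψ k‖ ^ 2 ≤ (1 + r) ^ 2 * ‖Ψ k‖ ^ 2 := by gcongr
    _ ≤ (2 + 2 * r ^ 2) * (M * ‖Ψ k‖) := by
        rw [sq ‖Ψ k‖]
        gcongr
        · nlinarith [sq_nonneg (1 - r)]
        · exact hM k
    _ = _ := by
        rw [hr]
        ring

end TestFunction

section Hoelder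

variable {α : Type*} [MeasurableSpace α] {μ : Measure α}

/-- Hölder's inequality for the exponents `2 / (2 - p)`, `2 / (p - 1)` and `2`. -/
theorem exists_integral_mul_rpow_mul_le {ξ : α → ℝ} {p : ℝ} (hp1 : 1 < p) (hp2 : p < 2)
    (hξ : MemLp ξ (ENNReal.ofReal (2 / (2 - p))) μ) :
    ∃ C : ℝ, 0 ≤ C ∧ ∀ u v : Lp ℝ 2 μ,
      Integrable (fun x => ξ x * |u x| ^ (p - 1) * |v x|) μ ∧
      ∫ x, ξ x * |u x| ^ (p - 1) * |v x| ∂μ ≤ C * ‖u‖ ^ (p - 1) * ‖v‖ := by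
  set a := ENNReal.ofReal (2 / (2 - p)) with ha
  set c := ENNReal.ofReal (2 / (p - 1)) with hc
  have hac : ENNReal.HolderTriple a c 2 := ⟨by
    rw [ha, hc, ← ENNReal.ofReal_inv_of_pos (div_pos two_pos (by linarith)),
      ← ENNReal.ofReal_inv_of_pos (div_pos two_pos (by linarith)),
      ← ENNReal.ofReal_add (by simp; linarith) (by simp; linarith),
      show (2 : ENNReal) = ENNReal.ofReal 2 by simp, ← ENNReal.ofReal_inv_of_pos two_pos]
    congr 1
    field_simp
    ring⟩
  refine ⟨(eLpNorm ξ a μ).toReal, ENNReal.toReal_nonneg, fun u v => ?_⟩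
  have hq : 0 < p - 1 := by linarith
  -- Thus `|u|^(p-1)` has `L^c` norm `‖u‖^(p-1)`. Hölder is then applied twice: `(a, c)` into `L²`,
  -- and `(2, 2)` into `L¹`.
  have hcq : c * ENNReal.ofReal (p - 1) = 2 := by
    rw [hc, ← ENNReal.ofReal_mul (by positivity), div_mul_cancel₀ _ hq.ne']
    simp
  have hum : AEStronglyMeasurable (fun x => |u x| ^ (p - 1)) μ := by
    have : AEMeasurable (fun x => |u x| ^ (p - 1)) μ :=
      ((Lp.aestronglyMeasurable u).aemeasurable.abs).pow_const _
    exact this.aestronglyMeasurable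
  have hunorm : eLpNorm (fun x => |u x| ^ (p - 1)) c μ = ENNReal.ofReal ‖u‖ ^ (p - 1) := by
    have := eLpNorm_norm_rpow (p := c) (μ := μ) (u : α → ℝ) hq
    rw [hcq] at this
    simp only [Real.norm_eq_abs] at this
    rw [this, Lp.norm_def, ENNReal.ofReal_toReal (Lp.eLpNorm_ne_top u)]
  have h1 : eLpNorm (fun x => ξ x * |u x| ^ (p - 1)) 2 μ
      ≤ eLpNorm ξ a μ * ENNReal.ofReal ‖u‖ ^ (p - 1) := by
    rw [← hunorm]
    exact eLpNorm_smul_le_mul_eLpNorm (f := fun x => |u x| ^ (p - 1)) (φ := ξ) hum hξ.1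
  have hvnorm : eLpNorm (fun x => |v x|) 2 μ = ENNReal.ofReal ‖v‖ := by
    have := eLpNorm_norm (p := 2) (μ := μ) (v : α → ℝ)
    simp only [Real.norm_eq_abs] at this
    rw [this, Lp.norm_def, ENNReal.ofReal_toReal (Lp.eLpNorm_ne_top v)]
  have hvm : AEStronglyMeasurable (fun x => |v x|) μ := (Lp.aestronglyMeasurable v).norm
  have h2 : eLpNorm (fun x => ξ x * |u x| ^ (p - 1) * |v x|) 1 μ
      ≤ eLpNorm ξ a μ * ENNReal.ofReal ‖u‖ ^ (p - 1) * ENNReal.ofReal ‖v‖ := by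
    refine (eLpNorm_smul_le_mul_eLpNorm (p := 2) (q := 2) (r := 1) (f := fun x => |v x|)
      (φ := fun x => ξ x * |u x| ^ (p - 1)) hvm (hξ.1.mul hum)).trans ?_
    rw [hvnorm]
    exact mul_le_mul_left h1 _
  have htop : eLpNorm ξ a μ * ENNReal.ofReal ‖u‖ ^ (p - 1) * ENNReal.ofReal ‖v‖ ≠ ⊤ := by
    finiteness [hξ.eLpNorm_ne_top]
  have hint : Integrable (fun x => ξ x * |u x| ^ (p - 1) * |v x|) μ :=
    memLp_one_iff_integrable.1 ⟨(hξ.1.mul hum).mul hvm, h2.trans_lt htop.lt_top⟩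
  refine ⟨hint, (le_abs_self _).trans ?_⟩
  rw [← Real.norm_eq_abs]
  refine (norm_integral_le_integral_norm _).trans ?_
  rw [← ENNReal.toReal_ofReal (integral_nonneg fun x => norm_nonneg _),
    ofReal_integral_norm_eq_lintegral_enorm hint, ← eLpNorm_one_eq_lintegral_enorm]
  refine (ENNReal.toReal_mono htop h2).trans ?_
  rw [ENNReal.toReal_mul, ENNReal.toReal_mul, ← ENNReal.toReal_rpow,
    ENNReal.toReal_ofReal (norm_nonneg _), ENNReal.toReal_ofReal (norm_nonneg _)]

end Hoelder

end FracSchrodinger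

/-! ### The nonlinearity and negative energy -/

namespace FracSchrodinger

variable {N : ℕ} {f : EuclideanSpace ℝ (Fin N) → ℝ → ℝ} {p : ℝ}
  {ξ : EuclideanSpace ℝ (Fin N) → ℝ}

theorem aestronglyMeasurable_nonlinearity
    (hf : Continuous (fun q : EuclideanSpace ℝ (Fin N) × ℝ => f q.1 q.2)) (u : L2R N) :
    AEStronglyMeasurable (fun x => f x (u x)) volume :=
  hf.comp_aestronglyMeasurable₂ aestronglyMeasurable_id (Lp.aestronglyMeasurable u)

theorem aestronglyMeasurable_primitiveF
    (hf : Continuous (fun q : EuclideanSpace ℝ (Fin N) × ℝ => f q.1 q.2)) (u : L2R N) :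
    AEStronglyMeasurable (fun x => primitiveF f x (u x)) volume := by
  have h : Continuous fun q : EuclideanSpace ℝ (Fin N) × ℝ => primitiveF f q.1 q.2 :=
    intervalIntegral.continuous_parametric_intervalIntegral_of_continuous
      (μ := volume) (f := fun (q : EuclideanSpace ℝ (Fin N) × ℝ) τ => f q.1 τ)
      (by
        change Continuous fun r : (EuclideanSpace ℝ (Fin N) × ℝ) × ℝ => f r.1.1 r.2
        exact hf.comp (by fun_prop : Continuous
          fun r : (EuclideanSpace ℝ (Fin N) × ℝ) × ℝ => (r.1.1, r.2)))
      continuous_snd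
  exact h.comp_aestronglyMeasurable₂ aestronglyMeasurable_id (Lp.aestronglyMeasurable u)

/-- The integrand is bounded by its growth bound at the endpoint. Losing the factor `1 / p` is
harmless, and the product form matches the trilinear Hölder bound with both functions equal. -/
theorem abs_primitiveF_le {x : EuclideanSpace ℝ (Fin N)} (hp1 : 1 < p) (hξ0 : 0 ≤ ξ x)
    (hfx : ∀ t : ℝ, |f x t| ≤ ξ x * |t| ^ (p - 1)) (t : ℝ) :
    |primitiveF f x t| ≤ ξ x * |t| ^ (p - 1) * |t| := by
  have h := intervalIntegral.norm_integral_le_of_norm_le_const (a := 0) (b := t)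
    (f := f x) (C := ξ x * |t| ^ (p - 1)) (fun τ hτ => by
      have hτt : |τ| ≤ |t| := by
        rcases Set.mem_uIoc.1 hτ with h | h
        · rw [abs_of_pos h.1]
          exact h.2.trans (le_abs_self t)
        · rw [abs_of_nonpos h.2, abs_of_nonpos (h.1.le.trans h.2)]
          linarith [h.1]
      refine (hfx τ).trans ?_
      have : 0 ≤ p - 1 := by linarith
      gcongr)
  simpa [primitiveF] using h

theorem exists_nonlinearity_bounds
    (hf : Continuous (fun q : EuclideanSpace ℝ (Fin N) × ℝ => f q.1 q.2))
    (hp1 : 1 < p) (hp2 : p < 2) (hξ0 : ∀ x, 0 ≤ ξ x)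
    (hξ : MemLp ξ (ENNReal.ofReal (2 / (2 - p))) volume)
    (hfξ : ∀ᵐ x ∂(volume : Measure (EuclideanSpace ℝ (Fin N))),
      ∀ t : ℝ, |f x t| ≤ ξ x * |t| ^ (p - 1)) :
    ∃ C : ℝ, 0 ≤ C ∧
      (∀ u v : L2R N, Integrable (fun x => f x (u x) * v x) volume ∧
        |∫ x, f x (u x) * v x| ≤ C * ‖u‖ ^ (p - 1) * ‖v‖) ∧
      ∀ u : L2R N, Integrable (fun x => primitiveF f x (u x)) volume ∧
        |∫ x, primitiveF f x (u x)| ≤ C * ‖u‖ ^ (p - 1) * ‖u‖ := by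
  obtain ⟨C, hC, hH⟩ := exists_integral_mul_rpow_mul_le hp1 hp2 hξ
  refine ⟨C, hC, fun u v => ?_, fun u => ?_⟩
  · have hle : ∀ᵐ x, ‖f x (u x) * v x‖ ≤ ξ x * |u x| ^ (p - 1) * |v x| := by
      filter_upwards [hfξ] with x hx
      rw [norm_mul, Real.norm_eq_abs, Real.norm_eq_abs]
      exact mul_le_mul_of_nonneg_right (hx _) (abs_nonneg _)
    exact ⟨(hH u v).1.mono' ((aestronglyMeasurable_nonlinearity hf u).mul
      (Lp.aestronglyMeasurable v)) hle,
      (norm_integral_le_of_norm_le (hH u v).1 hle).trans (hH u v).2⟩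
  · have hle : ∀ᵐ x, ‖primitiveF f x (u x)‖ ≤ ξ x * |u x| ^ (p - 1) * |u x| := by
      filter_upwards [hfξ] with x hx
      exact abs_primitiveF_le hp1 (hξ0 x) hx _
    exact ⟨(hH u u).1.mono' (aestronglyMeasurable_primitiveF hf u) hle,
      (norm_integral_le_of_norm_le (hH u u).1 hle).trans (hH u u).2⟩

/-- Continuity of `u ↦ ∫ f(x, u) v` along sequences converging in `L²` and almost everywhere. -/
theorem tendsto_integral_nonlinearity
    (hf : Continuous (fun q : EuclideanSpace ℝ (Fin N) × ℝ => f q.1 q.2))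
    (hp1 : 1 < p) (hp2 : p < 2) (hξ0 : ∀ x, 0 ≤ ξ x)
    (hξ : MemLp ξ (ENNReal.ofReal (2 / (2 - p))) volume)
    (hfξ : ∀ᵐ x ∂(volume : Measure (EuclideanSpace ℝ (Fin N))),
      ∀ t : ℝ, |f x t| ≤ ξ x * |t| ^ (p - 1))
    {u : ℕ → L2R N} {u₀ : L2R N} (hu : Tendsto u atTop (𝓝 u₀))
    (hae : ∀ᵐ x, Tendsto (fun n => u n x) atTop (𝓝 (u₀ x))) (v : L2R N) :
    Tendsto (fun n => ∫ x, f x (u n x) * v x) atTop (𝓝 (∫ x, f x (u₀ x) * v x)) := by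
  obtain ⟨C, hC, hH⟩ := exists_integral_mul_rpow_mul_le hp1 hp2 hξ
  obtain ⟨_, -, hB, -⟩ := exists_nonlinearity_bounds hf hp1 hp2 hξ0 hξ hfξ
  have hq : 0 < p - 1 := by linarith
  -- No majorant of `f(x, u n) v` uniform in `n` is at hand. The difference `d n` exceeds `G` by at
  -- most `e n`; its truncation at `G` is handled by dominated convergence, and `∫ e n → 0` by
  -- Hölder.
  set G : EuclideanSpace ℝ (Fin N) → ℝ := fun x => 2 * (ξ x * |u₀ x| ^ (p - 1) * |v x|) with hG
  have hGint : Integrable G volume := (hH u₀ v).1.const_mul 2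
  have hG0 : ∀ x, 0 ≤ G x := fun x => by
    have := hξ0 x
    simp only [hG]
    positivity
  set e : ℕ → EuclideanSpace ℝ (Fin N) → ℝ := fun n x =>
    ξ x * |(u n - u₀ : L2R N) x| ^ (p - 1) * |v x| with he
  set d : ℕ → EuclideanSpace ℝ (Fin N) → ℝ := fun n x =>
    |f x (u n x) * v x - f x (u₀ x) * v x| with hd
  have hdint : ∀ n, Integrable (d n) volume := fun n => ((hB (u n) v).1.sub (hB u₀ v).1).abs
  have hminint : ∀ n, Integrable (fun x => min (d n x) (G x)) volume :=
    fun n => (hdint n).inf hGint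
  have heint : ∀ n, Integrable (e n) volume := fun n => (hH (u n - u₀) v).1
  have hmin : Tendsto (fun n => ∫ x, min (d n x) (G x)) atTop (𝓝 0) := by
    have h := tendsto_integral_of_dominated_convergence (μ := volume)
      (F := fun n x => min (d n x) (G x)) (f := fun _ => (0 : ℝ)) G
      (fun n => (hminint n).aestronglyMeasurable) hGint
      (fun n => Eventually.of_forall fun x => by
        rw [Real.norm_of_nonneg (le_min (abs_nonneg _) (hG0 x))]
        exact min_le_right _ _)
      (by
        filter_upwards [hae] with x hx
        have h1 : Tendsto (fun n => f x (u n x)) atTop (𝓝 (f x (u₀ x))) :=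
          ((hf.comp (by fun_prop : Continuous fun t : ℝ => (x, t))).tendsto (u₀ x)).comp hx
        have h2 : Tendsto (fun n => d n x) atTop (𝓝 0) := by
          have := ((h1.mul_const (v x)).sub_const (f x (u₀ x) * v x)).abs
          simpa [hd] using this
        have h3 := h2.min (tendsto_const_nhds (x := G x))
        rwa [min_eq_left (hG0 x)] at h3)
    simpa using h
  have hetend : Tendsto (fun n => ∫ x, e n x) atTop (𝓝 0) := by
    have h1 : Tendsto (fun n => ‖u n - u₀‖) atTop (𝓝 0) := tendsto_iff_norm_sub_tendsto_zero.1 hu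
    have h2 : Tendsto (fun n => C * ‖u n - u₀‖ ^ (p - 1) * ‖v‖) atTop (𝓝 0) := by
      have := ((h1.rpow_const (p := p - 1) (Or.inr hq.le)).const_mul C).mul_const ‖v‖
      simpa [Real.zero_rpow hq.ne'] using this
    refine squeeze_zero (fun n => integral_nonneg fun x => ?_) (fun n => (hH (u n - u₀) v).2) h2
    have := hξ0 x
    simp only [he]
    positivity
  have hle : ∀ n, ∀ᵐ x, d n x ≤ min (d n x) (G x) + e n x := by
    intro n
    filter_upwards [hfξ, Lp.coeFn_sub (u n) u₀] with x hx hsub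
    have he0 : 0 ≤ e n x := by
      have := hξ0 x
      simp only [he]
      positivity
    -- Subadditivity of `t ↦ t^(p-1)`, as `0 < p - 1 < 1`.
    have hpow : |u n x| ^ (p - 1) ≤ |u₀ x| ^ (p - 1) + |(u n - u₀ : L2R N) x| ^ (p - 1) := by
      rw [hsub, Pi.sub_apply]
      have htri : |u n x| ≤ |u₀ x| + |u n x - u₀ x| := by
        have := abs_add_le (u₀ x) (u n x - u₀ x)
        simpa using this
      exact (Real.rpow_le_rpow (abs_nonneg _) htri hq.le).trans
        (Real.rpow_add_le_add_rpow (abs_nonneg _) (abs_nonneg _) hq.le (by linarith))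
    have hdG : d n x ≤ G x + e n x := by
      have h1 : |f x (u n x) * v x - f x (u₀ x) * v x|
          ≤ (ξ x * |u n x| ^ (p - 1) + ξ x * |u₀ x| ^ (p - 1)) * |v x| := by
        rw [← sub_mul, abs_mul]
        refine mul_le_mul_of_nonneg_right ?_ (abs_nonneg _)
        exact (abs_sub _ _).trans (add_le_add (hx _) (hx _))
      refine h1.trans ?_
      have h2 := mul_le_mul_of_nonneg_right
        (mul_le_mul_of_nonneg_left hpow (hξ0 x)) (abs_nonneg (v x))
      simp only [hG, he]
      linarith
    rcases le_total (d n x) (G x) with h | h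
    · rw [min_eq_left h]
      linarith
    · rw [min_eq_right h]
      exact hdG
  rw [tendsto_iff_norm_sub_tendsto_zero]
  refine squeeze_zero (fun n => norm_nonneg _) (fun n => ?_) (by simpa using hmin.add hetend)
  rw [← integral_sub (hB (u n) v).1 (hB u₀ v).1,
    ← integral_add (hminint n) (heint n)]
  exact (norm_integral_le_integral_norm _).trans
    (integral_mono_ae (hdint n) ((hminint n).add (heint n)) (hle n))

/-- The functional `½ ∫ |(-Δ)^{s/2} w|² - ∫ F(x, w)` takes a negative value on the functions
vanishing outside `Ω`. -/
theorem exists_memHsZero_energy_neg {s : ℝ} (hs : 0 ≤ s) (hs1 : s ≤ 1)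
    {Ω : Set (EuclideanSpace ℝ (Fin N))} (hΩ : IsOpen Ω) (hΩne : Ω.Nonempty)
    (hFint : ∀ u : L2R N, Integrable (fun x => primitiveF f x (u x)) volume)
    {η δ γ : ℝ} (hη : 0 < η) (hδ : 0 < δ) (hγ1 : 1 < γ) (hγ2 : γ < 2)
    (hF : ∀ x ∈ Ω, ∀ t : ℝ, |t| ≤ δ → η * |t| ^ γ ≤ primitiveF f x t) :
    ∃ w : L2R N, MemHsZero s Ω w ∧
      1 / 2 * ‖fracLaplacian (s / 2) w‖ ^ 2 - ∫ x, primitiveF f x (w x) < 0 := by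
  obtain ⟨x₀, hx₀⟩ := hΩne
  obtain ⟨φ, hφΩ, hφc, hφ, hφ01, hφx⟩ :=
    exists_contDiff_tsupport_subset (n := ⊤) (hΩ.mem_nhds hx₀)
  have hφ0 : ∀ x, 0 ≤ φ x := fun x => (hφ01 ⟨x, rfl⟩).1
  have hφ1 : ∀ x, φ x ≤ 1 := fun x => (hφ01 ⟨x, rfl⟩).2
  have hφmem : MemLp φ 2 (volume : Measure (EuclideanSpace ℝ (Fin N))) :=
    hφ.continuous.memLp_of_hasCompactSupport hφc
  set w : L2R N := hφmem.toLp φ with hw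
  have hwφ : w =ᵐ[volume] φ := hφmem.coeFn_toLp
  have hwHs : MemHs s w := memHs_of_ae_eq hs hs1 hφ hφc hwφ
  set A := ‖fracLaplacian (s / 2) w‖ ^ 2 with hA
  have hγ0 : 0 < γ := by linarith
  have hcγ : Continuous fun x => φ x ^ γ := hφ.continuous.rpow_const fun x => Or.inr hγ0.le
  have hcsγ : HasCompactSupport fun x => φ x ^ γ :=
    hφc.comp_left (g := fun t : ℝ => t ^ γ) (Real.zero_rpow hγ0.ne')
  set I := ∫ x, φ x ^ γ with hI
  have hIpos : 0 < I := hcγ.integral_pos_of_hasCompactSupport_nonneg_nonzero hcsγ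
    (fun x => Real.rpow_nonneg (hφ0 x) _) (x := x₀) (by simp [hφx])
  -- The quadratic part of the energy of `t • w` scales like `t²`, while the nonlinear gain is at
  -- least `t^γ η I`; dividing by `t^γ` gives the first condition. With `0 ≤ φ ≤ 1`, `t < δ` keeps
  -- `tφ` in the range of `hF`.
  obtain ⟨t, ⟨htA, htδ⟩, ht⟩ : ∃ t : ℝ, (t ^ (2 - γ) * (1 / 2 * A) < η * I ∧ t < δ) ∧ 0 < t := by
    have h : Tendsto (fun t : ℝ => t ^ (2 - γ) * (1 / 2 * A)) (𝓝[>] 0) (𝓝 0) := by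
      have hc : Continuous fun t : ℝ => t ^ (2 - γ) * (1 / 2 * A) :=
        (continuous_id.rpow_const fun t => Or.inr (by linarith)).mul_const _
      have := hc.tendsto 0
      rw [Real.zero_rpow (by linarith), zero_mul] at this
      exact this.mono_left nhdsWithin_le_nhds
    exact (((h.eventually (gt_mem_nhds (by positivity))).and
      (eventually_nhdsWithin_of_eventually_nhds (gt_mem_nhds hδ))).and self_mem_nhdsWithin).exists
  have htw : (t • w : L2R N) =ᵐ[volume] fun x => t * φ x := by
    filter_upwards [Lp.coeFn_smul t w, hwφ] with x h1 h2
    rw [h1, Pi.smul_apply, h2, smul_eq_mul]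
  have hzero : ∀ x, x ∉ Ω → φ x = 0 := fun x hx =>
    image_eq_zero_of_notMem_tsupport fun h => hx (hφΩ h)
  refine ⟨t • w, ⟨hwHs.smul t, ?_⟩, ?_⟩
  · filter_upwards [htw] with x hx hxΩ
    rw [hx, hzero x hxΩ, mul_zero]
  · have hFlow : t ^ γ * (η * I) ≤ ∫ x, primitiveF f x ((t • w : L2R N) x) := by
      rw [← mul_assoc, hI, ← integral_const_mul]
      refine integral_mono_ae ((hcγ.integrable_of_hasCompactSupport hcsγ).const_mul _)
        (hFint _) ?_
      filter_upwards [htw] with x hx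
      rw [hx]
      by_cases hxΩ : x ∈ Ω
      · have habs : |t * φ x| = t * φ x := abs_of_nonneg (mul_nonneg ht.le (hφ0 x))
        have h := hF x hxΩ (t * φ x) (by
          rw [habs]
          nlinarith [hφ1 x, hφ0 x])
        rw [habs, Real.mul_rpow ht.le (hφ0 x)] at h
        linarith
      · simp [hzero x hxΩ, primitiveF, Real.zero_rpow hγ0.ne']
    have hquad : 1 / 2 * ‖fracLaplacian (s / 2) (t • w)‖ ^ 2
        = t ^ γ * (t ^ (2 - γ) * (1 / 2 * A)) := by
      rw [hwHs.norm_fracLaplacian_smul, mul_pow, sq_abs, ← mul_assoc (t ^ γ), ← Real.rpow_add ht]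
      simp
      ring
    rw [hquad]
    have := mul_lt_mul_of_pos_left htA (Real.rpow_pos_of_pos ht γ)
    linarith

end FracSchrodinger

/-! ### Concentration, a priori bounds and testing the equation -/

namespace FracSchrodinger

variable {N : ℕ} {s : ℝ} {V : EuclideanSpace ℝ (Fin N) → ℝ}

theorem integrable_sq (u : L2R N) : Integrable (fun x => (u x) ^ 2) volume := by
  simpa using integrable_norm_sq u

theorem setIntegral_sub_sq_le (u v : L2R N) (S : Set (EuclideanSpace ℝ (Fin N))) :
    ∫ x in S, ((u - v : L2R N) x) ^ 2
      ≤ 2 * (∫ x in S, (u x) ^ 2) + 2 * ∫ x in S, (v x) ^ 2 := by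
  have iu := ((integrable_sq u).integrableOn (s := S)).const_mul 2
  have iv := ((integrable_sq v).integrableOn (s := S)).const_mul 2
  rw [← integral_const_mul, ← integral_const_mul, ← integral_add iu iv]
  refine integral_mono_ae (integrable_sq _).integrableOn (iu.add iv) (ae_restrict_of_ae ?_)
  filter_upwards [Lp.coeFn_sub u v] with x hx
  simp only [hx, Pi.sub_apply]
  nlinarith [sq_nonneg (u x + v x)]

theorem setIntegral_sq_le_norm_sq (u : L2R N) (S : Set (EuclideanSpace ℝ (Fin N))) :
    ∫ x in S, (u x) ^ 2 ≤ ‖u‖ ^ 2 := by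
  simpa using setIntegral_norm_sq_le u S

theorem norm_sq_eq_setIntegral_add_compl (u : L2R N) {S : Set (EuclideanSpace ℝ (Fin N))}
    (hS : MeasurableSet S) :
    ‖u‖ ^ 2 = (∫ x in S, (u x) ^ 2) + ∫ x in Sᶜ, (u x) ^ 2 := by
  rw [integral_add_compl hS (integrable_sq u), norm_sq_eq_integral]
  simp

/-- The sublevel shells `{0 < V < c}` have arbitrarily small measure. -/
theorem exists_volume_shell_lt (hV : Continuous V) {b : ℝ} (hb : 0 < b)
    (hVb : volume {x | V x < b} < ⊤) {d : ℝ} (hd : 0 < d) :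
    ∃ c : ℝ, 0 < c ∧ volume {x | 0 < V x ∧ V x < c} ≠ ⊤ ∧
      volume.real {x | 0 < V x ∧ V x < c} < d := by
  set T : ℕ → Set (EuclideanSpace ℝ (Fin N)) := fun k => {x | 0 < V x ∧ V x < b / (k + 1)} with hT
  have hbk : ∀ k : ℕ, b / (k + 1) ≤ b := fun k =>
    div_le_self hb.le (by linarith [Nat.cast_nonneg (α := ℝ) k])
  have hfin : ∀ k, volume (T k) ≠ ⊤ := fun k =>
    ((measure_mono fun x hx => lt_of_lt_of_le hx.2 (hbk k)).trans_lt hVb).ne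
  have hanti : Antitone T := fun i j hij x hx => ⟨hx.1, hx.2.trans_le (by gcongr)⟩
  have hempty : ⋂ k, T k = ∅ := by
    refine Set.eq_empty_of_forall_notMem fun x hx => ?_
    rw [Set.mem_iInter] at hx
    obtain ⟨k, hk⟩ := exists_nat_gt (b / V x)
    have h0 := (hx 0).1
    have h1 := (hx k).2
    rw [lt_div_iff₀ (by positivity)] at h1
    rw [div_lt_iff₀ h0] at hk
    nlinarith
  have hmeas : ∀ k, MeasurableSet (T k) := fun k =>
    ((isOpen_lt continuous_const hV).inter (isOpen_lt hV continuous_const)).measurableSet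
  have hlim := tendsto_measure_iInter_atTop (μ := volume)
    (fun k => (hmeas k).nullMeasurableSet) hanti ⟨0, hfin 0⟩
  rw [hempty, measure_empty] at hlim
  obtain ⟨k, hk⟩ := (hlim.eventually (gt_mem_nhds (ENNReal.ofReal_pos.2 hd))).exists
  refine ⟨b / (k + 1), by positivity, hfin k, ?_⟩
  exact (ENNReal.toReal_lt_of_lt_ofReal hk)

/-- Concentration on the zero set of the potential. -/
theorem tendsto_setIntegral_sq_compl_zero (hs : 0 < s) (hV : Continuous V)
    (hV0 : ∀ x, 0 ≤ V x) {b : ℝ} (hb : 0 < b) (hVb : volume {x | V x < b} < ⊤)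
    {u : ℕ → L2R N} {K : ℝ} (hu : ∀ n, MemEnergySpace s V (u n)) (hK : ∀ n, ‖u n‖ ≤ K)
    (hK' : ∀ n, ‖fracLaplacian (s / 2) (u n)‖ ≤ K)
    (hlim : Tendsto (fun n => ∫ x, V x * u n x ^ 2) atTop (𝓝 0)) :
    Tendsto (fun n => ∫ x in (V ⁻¹' {0})ᶜ, (u n x) ^ 2) atTop (𝓝 0) := by
  rw [Metric.tendsto_nhds]
  intro ε hε
  -- Order of choices: `d` from uniform smallness, then the shell height `c`, then `n` large for
  -- Chebyshev on `{V ≥ c}`.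
  obtain ⟨d, hd, hsmall⟩ := exists_setIntegral_sq_lt (N := N) hs K (half_pos hε)
  obtain ⟨c, hc, hfin, hcd⟩ := exists_volume_shell_lt hV hb hVb hd
  have hlim' : Tendsto (fun n => 1 / c * ∫ x, V x * u n x ^ 2) atTop (𝓝 0) := by
    simpa using hlim.const_mul (1 / c)
  have hmeas : MeasurableSet {x | V x < c} := (isOpen_lt hV continuous_const).measurableSet
  have hsplit : (V ⁻¹' {0})ᶜ ∩ {x | V x < c} = {x | 0 < V x ∧ V x < c} := by
    ext x
    simp only [Set.mem_inter_iff, Set.mem_compl_iff, Set.mem_preimage, Set.mem_singleton_iff,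
      Set.mem_ofPred_eq, (hV0 x).lt_iff_ne']
  have hzero : MeasurableSet (V ⁻¹' {0})ᶜ := (hV.measurable (measurableSet_singleton 0)).compl
  filter_upwards [hlim'.eventually (gt_mem_nhds (half_pos hε))] with n hn
  rw [Real.dist_eq, sub_zero, abs_of_nonneg (integral_nonneg fun x => by positivity),
    ← integral_inter_add_sdiff hmeas (integrable_sq (u n)).integrableOn, hsplit]
  have h1 := hsmall _ hfin hcd (u n) (hu n).1 (hK n) (hK' n)
  have h2 := setIntegral_sq_le_one_div_mul hV0 (hu n).2 hc (hzero.diff hmeas)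
    fun x hx => by simpa using hx.2
  linarith

/-- A priori bounds for weak solutions. -/
theorem exists_weakSolution_bound {f : EuclideanSpace ℝ (Fin N) → ℝ → ℝ} {p C C' : ℝ}
    (hp1 : 1 < p) (hp2 : p < 2) (hV0 : ∀ x, 0 ≤ V x) (hC : 0 ≤ C)
    (hC' : 0 < C') (hcoer : ∀ u : L2R N, MemEnergySpace s V u →
      ‖u‖ ^ 2 ≤ C' * (‖fracLaplacian (s / 2) u‖ ^ 2 + ∫ x, V x * u x ^ 2))
    (hgrow : ∀ u v : L2R N, |∫ x, f x (u x) * v x| ≤ C * ‖u‖ ^ (p - 1) * ‖v‖) :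
    ∃ K : ℝ, ∀ (lam : ℝ) (u : L2R N), 1 ≤ lam → IsWeakSolution s lam V f u →
      ‖u‖ ≤ K ∧ ‖fracLaplacian (s / 2) u‖ ≤ K ∧ lam * (∫ x, V x * u x ^ 2) ≤ K := by
  -- Coercivity and the tested equation give `‖u‖² ≤ C' C ‖u‖^p`, which `p < 2` turns into this
  -- bound.
  set K₀ := (C' * C) ^ (2 - p)⁻¹ with hK₀
  have hK₀0 : 0 ≤ K₀ := by positivity
  set K₁ := C * K₀ ^ (p - 1) * K₀ with hK₁
  have hK₁0 : 0 ≤ K₁ := by positivity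
  refine ⟨K₀ + K₁ + 1, fun lam u hlam hu => ?_⟩
  have hVu : 0 ≤ ∫ x, V x * u x ^ 2 := integral_nonneg fun x => by
    have := hV0 x
    positivity
  have hVlam : (∫ x, V x * u x ^ 2) ≤ lam * ∫ x, V x * u x ^ 2 := le_mul_of_one_le_left hVu hlam
  have htest : ‖fracLaplacian (s / 2) u‖ ^ 2 + lam * (∫ x, V x * u x ^ 2)
      ≤ C * ‖u‖ ^ (p - 1) * ‖u‖ := by
    have h := hu.2 u hu.1
    rw [hsForm_self] at h
    simp only [mul_assoc, ← sq] at h ⊢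
    rw [h, ← mul_assoc]
    exact (le_abs_self _).trans (by simpa only [sq] using hgrow u u)
  have hu0 := norm_nonneg u
  have hnorm : ‖u‖ ≤ K₀ := by
    rcases hu0.eq_or_lt with h0 | h0
    · rw [← h0]
      exact hK₀0
    have h1 : ‖u‖ ^ 2 ≤ C' * C * ‖u‖ ^ p := by
      have e : ‖u‖ ^ p = ‖u‖ ^ (p - 1) * ‖u‖ := by
        rw [← Real.rpow_add_one h0.ne', sub_add_cancel]
      refine (hcoer u hu.1).trans ?_
      rw [mul_assoc, e, ← mul_assoc C]
      exact mul_le_mul_of_nonneg_left (by linarith) hC'.le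
    have h2 : ‖u‖ ^ (2 - p) ≤ C' * C := by
      rw [Real.rpow_sub h0, div_le_iff₀ (by positivity)]
      exact_mod_cast h1
    rw [hK₀, Real.le_rpow_inv_iff_of_pos h0.le (by positivity) (by linarith)]
    exact h2
  have hbound : ‖fracLaplacian (s / 2) u‖ ^ 2 + lam * (∫ x, V x * u x ^ 2) ≤ K₁ := by
    refine htest.trans ?_
    have : 0 ≤ p - 1 := by linarith
    rw [hK₁]
    gcongr
  refine ⟨by linarith, ?_, ?_⟩
  · refine abs_le_of_sq_le_sq' ?_ (by positivity) |>.2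
    nlinarith
  · nlinarith [sq_nonneg ‖fracLaplacian (s / 2) u‖]

/-- A bounded sequence in `H^s` which concentrates on a set of finite measure has a subsequence
which converges in `L²`. -/
theorem exists_subseq_tendsto_of_concentrating (hs : 0 < s) {u : ℕ → L2R N} {K : ℝ}
    (hu : ∀ n, MemHs s (u n)) (hK : ∀ n, ‖u n‖ ≤ K)
    (hK' : ∀ n, ‖fracLaplacian (s / 2) (u n)‖ ≤ K)
    {Z : Set (EuclideanSpace ℝ (Fin N))} (hZ : MeasurableSet Z) (hZfin : volume Z ≠ ⊤)
    (hconc : Tendsto (fun n => ∫ x in Zᶜ, (u n x) ^ 2) atTop (𝓝 0)) :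
    ∃ (θ : ℕ → ℕ) (u₀ : L2R N), StrictMono θ ∧ Tendsto (fun n => u (θ n)) atTop (𝓝 u₀) ∧
      (∀ᵐ x, Tendsto (fun n => u (θ n) x) atTop (𝓝 (u₀ x))) ∧
      ∀ᵐ x ∂(volume : Measure (EuclideanSpace ℝ (Fin N))), x ∉ Z → u₀ x = 0 := by
  obtain ⟨θ, hθ, hin⟩ := exists_subseq_setIntegral_sq_tendsto hs hu hK hK' hZfin
  have hconcθ := hconc.comp hθ.tendsto_atTop
  have hout : Tendsto (fun q : ℕ × ℕ => 2 * (∫ x in Zᶜ, (u (θ q.1) x) ^ 2)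
      + 2 * ∫ x in Zᶜ, (u (θ q.2) x) ^ 2) atTop (𝓝 0) := by
    rw [← prod_atTop_atTop_eq]
    simpa using ((hconcθ.comp tendsto_fst).const_mul 2).add ((hconcθ.comp tendsto_snd).const_mul 2)
  have hcauchy : CauchySeq fun n => u (θ n) := by
    rw [cauchySeq_iff_tendsto_dist_atTop_0]
    have hsq : Tendsto (fun q : ℕ × ℕ => ‖u (θ q.1) - u (θ q.2)‖ ^ 2) atTop (𝓝 0) := by
      refine squeeze_zero (fun q => by positivity) (fun q => ?_) (by simpa using hin.add hout)
      rw [norm_sq_eq_setIntegral_add_compl _ hZ]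
      exact add_le_add le_rfl (setIntegral_sub_sq_le _ _ _)
    simpa [dist_eq_norm, Real.sqrt_sq (norm_nonneg _)] using hsq.sqrt
  obtain ⟨u₀, hu₀⟩ := cauchySeq_tendsto_of_complete hcauchy
  -- A further subsequence gives convergence almost everywhere, needed later for the nonlinearity.
  obtain ⟨ψ, hψ, hae⟩ := (tendstoInMeasure_of_tendsto_Lp hu₀).exists_seq_tendsto_ae
  refine ⟨θ ∘ ψ, u₀, hθ.comp hψ, hu₀.comp hψ.tendsto_atTop, hae, ?_⟩
  have hzero : ∫ x in Zᶜ, (u₀ x) ^ 2 = 0 := by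
    refine le_antisymm ?_ (integral_nonneg fun x => by positivity)
    have hlim : Tendsto (fun n => 2 * (∫ x in Zᶜ, (u (θ n) x) ^ 2)
        + 2 * ‖u (θ n) - u₀‖ ^ 2) atTop (𝓝 0) := by
      simpa using (hconcθ.const_mul 2).add
        (((tendsto_iff_norm_sub_tendsto_zero.1 hu₀).pow 2).const_mul 2)
    refine ge_of_tendsto' hlim fun n => ?_
    have h := setIntegral_sub_sq_le (u (θ n)) (u (θ n) - u₀) Zᶜ
    rw [sub_sub_cancel] at h
    have h' := setIntegral_sq_le_norm_sq (u (θ n) - u₀) Zᶜ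
    linarith
  rw [integral_eq_zero_iff_of_nonneg (fun x => by positivity) (integrable_sq u₀).integrableOn,
    EventuallyEq, ae_restrict_iff' hZ.compl] at hzero
  filter_upwards [hzero] with x hx hxZ
  simpa using hx hxZ

/-- The energy is bounded below by the nonlinear term. -/
theorem neg_abs_integral_primitiveF_le_energy {lam : ℝ} (hlam : 0 ≤ lam) (hV0 : ∀ x, 0 ≤ V x)
    (f : EuclideanSpace ℝ (Fin N) → ℝ → ℝ) (u : L2R N) :
    -|∫ x, primitiveF f x (u x)| ≤ energy s lam V f u := by
  have hVu : 0 ≤ ∫ x, V x * u x ^ 2 := integral_nonneg fun x => by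
    have := hV0 x
    positivity
  have h1 : 0 ≤ lam / 2 * ∫ x, V x * u x ^ 2 := by positivity
  have h2 : 0 ≤ 1 / 2 * ‖fracLaplacian (s / 2) u‖ ^ 2 := by positivity
  have h3 := le_abs_self (∫ x, primitiveF f x (u x))
  unfold energy
  linarith

theorem potential_mul_ae_eq_zero {Ω : Set (EuclideanSpace ℝ (Fin N))}
    (hVΩ : ∀ x ∈ Ω, V x = 0) {v : L2R N} (hv : MemHsZero s Ω v) : ∀ᵐ x, V x * v x = 0 := by
  filter_upwards [hv.2] with x hx
  by_cases hxΩ : x ∈ Ω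
  · rw [hVΩ x hxΩ, zero_mul]
  · rw [hx hxΩ, mul_zero]

theorem MemHsZero.memEnergySpace {Ω : Set (EuclideanSpace ℝ (Fin N))}
    (hVΩ : ∀ x ∈ Ω, V x = 0) {v : L2R N} (hv : MemHsZero s Ω v) : MemEnergySpace s V v := by
  refine ⟨hv.1, (integrable_zero (EuclideanSpace ℝ (Fin N)) ℝ volume).congr ?_⟩
  filter_upwards [potential_mul_ae_eq_zero hVΩ hv] with x hx
  rw [sq, ← mul_assoc, hx, zero_mul, Pi.zero_apply]

/-- The potential vanishes where the test function lives, so `λ` drops out and the identity can pass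
to the limit. -/
theorem IsWeakSolution.hsForm_eq {Ω : Set (EuclideanSpace ℝ (Fin N))} {lam : ℝ}
    {f : EuclideanSpace ℝ (Fin N) → ℝ → ℝ} {u : L2R N} (hu : IsWeakSolution s lam V f u)
    (hVΩ : ∀ x ∈ Ω, V x = 0) {v : L2R N} (hv : MemHsZero s Ω v) :
    hsForm s u v = ∫ x, f x (u x) * v x := by
  have h0 : ∫ x, V x * u x * v x = 0 := integral_eq_zero_of_ae (by
    filter_upwards [potential_mul_ae_eq_zero hVΩ hv] with x hx
    rw [mul_right_comm, hx, zero_mul, Pi.zero_apply])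
  have h := hu.2 v (hv.memEnergySpace hVΩ)
  rwa [h0, mul_zero, add_zero] at h

/-- Testing the equation with `u - u₀` bounds the seminorm distance of a weak solution `u` to a
function `u₀` vanishing outside `Ω`. -/
theorem IsWeakSolution.norm_fracLaplacian_sub_sq_le {Ω : Set (EuclideanSpace ℝ (Fin N))} {lam : ℝ}
    (hlam : 0 ≤ lam) (hV0 : ∀ x, 0 ≤ V x)
    {f : EuclideanSpace ℝ (Fin N) → ℝ → ℝ} {u u₀ : L2R N} (hu : IsWeakSolution s lam V f u)
    (hVΩ : ∀ x ∈ Ω, V x = 0) (hu₀ : MemHsZero s Ω u₀) :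
    ‖fracLaplacian (s / 2) (u - u₀)‖ ^ 2
      ≤ |∫ x, f x (u x) * (u - u₀ : L2R N) x| + |hsForm s u₀ (u - u₀)| := by
  have hV₀ := potential_mul_ae_eq_zero hVΩ hu₀
  have hmem : MemEnergySpace s V (u - u₀) := by
    refine ⟨hu.1.1.sub hu₀.1, hu.1.2.congr ?_⟩
    filter_upwards [hV₀, Lp.coeFn_sub u u₀] with x h1 h2
    rw [h2, Pi.sub_apply]
    linear_combination (2 * u x - u₀ x) * h1
  -- As `V u₀ = 0`, this integrand equals `V u²`; the potential term may be discarded, whatever `λ`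
  -- is.
  have hpos : 0 ≤ ∫ x, V x * u x * (u - u₀ : L2R N) x := by
    refine integral_nonneg_of_ae ?_
    filter_upwards [hV₀, Lp.coeFn_sub u u₀] with x h1 h2
    have e : V x * u x * (u - u₀ : L2R N) x = V x * u x ^ 2 := by
      rw [h2, Pi.sub_apply]
      linear_combination (-u x) * h1
    have := hV0 x
    rw [e, Pi.zero_apply]
    positivity
  have htest := hu.2 _ hmem
  have hself := hsForm_self (s := s) (u - u₀)
  rw [hu.1.1.hsForm_sub_left hu₀.1] at hself
  have h1 := le_abs_self (∫ x, f x (u x) * (u - u₀ : L2R N) x)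
  have h2 := neg_abs_le (hsForm s u₀ (u - u₀))
  have h3 := mul_nonneg hlam hpos
  linarith

end FracSchrodinger

/-! ### Passage to the limit -/

namespace FracSchrodinger

/-- The conclusion for parameters which are at least `1`. -/
theorem exists_subseq_tendsto_and_concentration (N : ℕ) (hN : 1 ≤ N)
    (s : ℝ) (hs0 : 0 < s) (hs1 : s < 1)
    (V : EuclideanSpace ℝ (Fin N) → ℝ) (hVcont : Continuous V) (hVnonneg : ∀ x, 0 ≤ V x)
    (hVb : ∃ b : ℝ, 0 < b ∧ {x | V x < b}.Nonempty ∧ volume {x | V x < b} < ⊤)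
    (Ω : Set (EuclideanSpace ℝ (Fin N))) (hΩ : Ω = interior (V ⁻¹' {0}))
    (hΩne : Ω.Nonempty) (hΩsmooth : HasSmoothBoundary Ω)
    (hΩclosure : closure Ω = V ⁻¹' {0})
    (f : EuclideanSpace ℝ (Fin N) → ℝ → ℝ) (hf : Continuous (fun q : _ × ℝ => f q.1 q.2))
    (p : ℝ) (hp1 : 1 < p) (hp2 : p < 2)
    (ξ : EuclideanSpace ℝ (Fin N) → ℝ) (hξnonneg : ∀ x, 0 ≤ ξ x)
    (hξ : MemLp ξ (ENNReal.ofReal (2 / (2 - p))) volume)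
    (hfξ : ∀ᵐ x ∂(volume : Measure (EuclideanSpace ℝ (Fin N))),
      ∀ t : ℝ, |f x t| ≤ ξ x * |t| ^ (p - 1))
    (η δ γ : ℝ) (hη : 0 < η) (hδ : 0 < δ) (hγ1 : 1 < γ) (hγ2 : γ < 2)
    (hF : ∀ x ∈ Ω, ∀ t : ℝ, |t| ≤ δ → η * |t| ^ γ ≤ primitiveF f x t)
    (lam : ℕ → ℝ) (hlam1 : ∀ n, 1 ≤ lam n) (hlam : Tendsto lam atTop atTop)
    (u : ℕ → L2R N)
    (hu : ∀ n, IsMinimizingSolution s (lam n) V f (u n)) :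
    (∃ (θ : ℕ → ℕ) (u₀ : L2R N), StrictMono θ ∧
      IsWeakDirichletSolution s Ω f u₀ ∧ u₀ ≠ 0 ∧
      Tendsto (fun n => hsNorm s (u (θ n) - u₀)) atTop (𝓝 0)) ∧
    Tendsto (fun n => ∫ x in (V ⁻¹' {0})ᶜ, (u n x) ^ 2) atTop (𝓝 0) := by
  obtain ⟨b, hb, -, hVbfin⟩ := hVb
  have hZfin : volume (V ⁻¹' {0}) ≠ ⊤ :=
    ((measure_mono fun x (hx : V x = 0) => show V x < b by rwa [hx]).trans_lt hVbfin).ne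
  have hZmeas : MeasurableSet (V ⁻¹' {0}) := hVcont.measurable (measurableSet_singleton 0)
  have hΩopen : IsOpen Ω := hΩ ▸ isOpen_interior
  have hVΩ : ∀ x ∈ Ω, V x = 0 := fun x hx => 
    interior_subset (s := V ⁻¹' {0}) (by rwa [hΩ] at hx)
  obtain ⟨C, hC, hfC, hFC⟩ := exists_nonlinearity_bounds hf hp1 hp2 hξnonneg hξ hfξ
  obtain ⟨C', hC', hcoer⟩ := exists_norm_sq_le hN hs0.le hVcont hVnonneg hb hVbfin
  obtain ⟨K, hKall⟩ := exists_weakSolution_bound hp1 hp2 hVnonneg hC hC' hcoer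
    fun u v => (hfC u v).2
  have hK := fun n => (hKall (lam n) (u n) (hlam1 n) (hu n).1).1
  have hK' := fun n => (hKall (lam n) (u n) (hlam1 n) (hu n).1).2.1
  have hVlim : Tendsto (fun n => ∫ x, V x * u n x ^ 2) atTop (𝓝 0) := by
    refine squeeze_zero (fun n => integral_nonneg fun x => ?_) (fun n => ?_)
      (hlam.const_div_atTop K)
    · have := hVnonneg x
      positivity
    · rw [le_div_iff₀' (by linarith [hlam1 n])]
      exact (hKall (lam n) (u n) (hlam1 n) (hu n).1).2.2
  have hconc := tendsto_setIntegral_sq_compl_zero hs0 hVcont hVnonneg hb hVbfin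
    (fun n => (hu n).1.1) hK hK' hVlim
  refine ⟨?_, hconc⟩
  obtain ⟨θ, u₀, hθ, hlim, hae, hzero⟩ := exists_subseq_tendsto_of_concentrating hs0
    (fun n => (hu n).1.1.1) hK hK' hZmeas hZfin hconc
  have hnormlim : Tendsto (fun n => ‖u (θ n) - u₀‖) atTop (𝓝 0) :=
    tendsto_iff_norm_sub_tendsto_zero.1 hlim
  have hu₀Hs : MemHs s u₀ := memHs_of_tendsto (fun n => (hu (θ n)).1.1.1) (fun n => hK' (θ n)) hlim
  have hu₀ : MemHsZero s Ω u₀ := by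
    refine ⟨hu₀Hs, ?_⟩
    -- `u₀` is known to vanish only off `V⁻¹(0) = closure Ω`; the remaining set is the null
    -- frontier.
    have hfr : ∀ᵐ x ∂(volume : Measure (EuclideanSpace ℝ (Fin N))), x ∉ frontier Ω :=
      measure_eq_zero_iff_ae_notMem.1 (hΩsmooth.volume_frontier_eq_zero hΩopen)
    filter_upwards [hzero, hfr] with x hx hxfr hxΩ
    refine hx fun hxZ => hxfr ?_
    rw [hΩopen.frontier_eq, hΩclosure]
    exact ⟨hxZ, hxΩ⟩
  -- convergence of the half Laplacians
  have hDlim : Tendsto (fun n => ‖fracLaplacian (s / 2) (u (θ n) - u₀)‖ ^ 2) atTop (𝓝 0) := by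
    have hweak := tendsto_hsForm_of_tendsto (v := u₀) (u := fun n => u (θ n) - u₀)
      (K := K + ‖fracLaplacian (s / 2) u₀‖) hs0.le
      (fun n => (hu (θ n)).1.1.1.sub hu₀Hs)
      (fun n => by
        rw [(hu (θ n)).1.1.1.fracLaplacian_sub hu₀Hs]
        exact (norm_sub_le _ _).trans (add_le_add (hK' _) le_rfl))
      (by simpa using hlim.sub_const u₀)
    have hbound : Tendsto (fun n => C * K ^ (p - 1) * ‖u (θ n) - u₀‖
        + |hsForm s u₀ (u (θ n) - u₀)|) atTop (𝓝 0) := by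
      simpa using (hnormlim.const_mul (C * K ^ (p - 1))).add hweak.abs
    refine squeeze_zero (fun n => by positivity) (fun n => ?_) hbound
    refine ((hu (θ n)).1.norm_fracLaplacian_sub_sq_le (by linarith [hlam1 (θ n)]) hVnonneg hVΩ
      hu₀).trans (add_le_add ((hfC _ _).2.trans ?_) le_rfl)
    have hq : 0 ≤ p - 1 := by linarith
    have := hK (θ n)
    gcongr
  have hDlim' : Tendsto (fun n => ‖fracLaplacian (s / 2) (u (θ n) - u₀)‖) atTop (𝓝 0) := by
    simpa [Real.sqrt_sq (norm_nonneg _)] using hDlim.sqrt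
  refine ⟨θ, u₀, hθ, ⟨hu₀, fun v hv => ?_⟩, ?_, ?_⟩
  · have hleft : Tendsto (fun n => hsForm s (u (θ n)) v) atTop (𝓝 (hsForm s u₀ v)) := by
      rw [tendsto_iff_norm_sub_tendsto_zero]
      refine squeeze_zero (fun n => norm_nonneg _) (fun n => ?_)
        (by simpa using hDlim'.mul_const ‖fracLaplacian (s / 2) v‖)
      rw [← (hu (θ n)).1.1.1.hsForm_sub_left hu₀Hs]
      exact abs_hsForm_le _ _
    have hright := tendsto_integral_nonlinearity hf hp1 hp2 hξnonneg hξ hfξ hlim hae v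
    have heq : ∀ n, hsForm s (u (θ n)) v = ∫ x, f x (u (θ n) x) * v x :=
      fun n => (hu (θ n)).1.hsForm_eq hVΩ hv
    rw [tendsto_nhds_unique (hleft.congr heq) hright]
    refine (setIntegral_eq_integral_of_ae_compl_eq_zero ?_).symm
    filter_upwards [hv.2] with x hx hxΩ
    rw [hx hxΩ, mul_zero]
  · rintro rfl
    obtain ⟨w, hw, hwneg⟩ := exists_memHsZero_energy_neg hs0.le hs1.le hΩopen hΩne
      (fun u => (hFC u).1) hη hδ hγ1 hγ2 hF
    have hwE := hw.memEnergySpace hVΩ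
    have hVw : ∫ x, V x * w x ^ 2 = 0 := integral_eq_zero_of_ae (by
      filter_upwards [potential_mul_ae_eq_zero hVΩ hw] with x hx
      rw [sq, ← mul_assoc, hx, zero_mul, Pi.zero_apply])
    -- The energy of `w` does not involve `λ`, so minimality compares every `u (θ n)` with the same
    -- negative number, while the left side tends to `0`.
    have hle : ∀ n, -(C * ‖u (θ n)‖ ^ (p - 1) * ‖u (θ n)‖)
        ≤ 1 / 2 * ‖fracLaplacian (s / 2) w‖ ^ 2 - ∫ x, primitiveF f x (w x) := fun n => by
      have h1 := (hu (θ n)).2 w hwE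
      have h2 := neg_abs_integral_primitiveF_le_energy (s := s) (V := V)
        (by linarith [hlam1 (θ n)] : 0 ≤ lam (θ n)) hVnonneg f (u (θ n))
      have h3 := (hFC (u (θ n))).2
      rw [energy.eq_1 s _ V f w, hVw, mul_zero, add_zero] at h1
      linarith
    have hlim0 : Tendsto (fun n => -(C * ‖u (θ n)‖ ^ (p - 1) * ‖u (θ n)‖)) atTop (𝓝 0) := by
      have h0 : Tendsto (fun n => ‖u (θ n)‖) atTop (𝓝 0) := by simpa using hlim.norm
      have hq : 0 ≤ p - 1 := by linarith
      simpa using (((h0.rpow_const (p := p - 1) (Or.inr hq)).const_mul C).mul h0).neg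
    exact absurd (le_of_tendsto' hlim0 hle) (not_le.2 hwneg)
  · have h := (hDlim.add (hnormlim.pow 2)).sqrt
    simpa [hsNorm] using h

end FracSchrodinger

theorem theorem1p2 (N : ℕ) (hN : 1 ≤ N) (s : ℝ) (hs0 : 0 < s) (hs1 : s < 1)
    -- the potential
    (V : EuclideanSpace ℝ (Fin N) → ℝ) (hVcont : Continuous V) (hVnonneg : ∀ x, 0 ≤ V x)
    (hVb : ∃ b : ℝ, 0 < b ∧ {x | V x < b}.Nonempty ∧ volume {x | V x < b} < ⊤)
    (Ω : Set (EuclideanSpace ℝ (Fin N))) (hΩ : Ω = interior (V ⁻¹' {0}))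
    (hΩne : Ω.Nonempty) (hΩsmooth : FracSchrodinger.HasSmoothBoundary Ω)
    (hΩclosure : closure Ω = V ⁻¹' {0})
    -- the nonlinearity
    (f : EuclideanSpace ℝ (Fin N) → ℝ → ℝ) (hf : Continuous (fun q : _ × ℝ => f q.1 q.2))
    (p : ℝ) (hp1 : 1 < p) (hp2 : p < 2)
    (ξ : EuclideanSpace ℝ (Fin N) → ℝ) (hξnonneg : ∀ x, 0 ≤ ξ x)
    (hξ : MemLp ξ (ENNReal.ofReal (2 / (2 - p))) volume)
    (hfξ : ∀ᵐ x ∂(volume : Measure (EuclideanSpace ℝ (Fin N))),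
      ∀ t : ℝ, |f x t| ≤ ξ x * |t| ^ (p - 1))
    (η δ γ : ℝ) (hη : 0 < η) (hδ : 0 < δ) (hγ1 : 1 < γ) (hγ2 : γ < 2)
    (hF : ∀ x ∈ Ω, ∀ t : ℝ, |t| ≤ δ → η * |t| ^ γ ≤ FracSchrodinger.primitiveF f x t)
    -- the minimizing solutions along a sequence of parameters tending to infinity
    (lam : ℕ → ℝ) (hlampos : ∀ n, 0 < lam n) (hlam : Tendsto lam atTop atTop)
    (u : ℕ → FracSchrodinger.L2R N)
    (hu : ∀ n, FracSchrodinger.IsMinimizingSolution s (lam n) V f (u n)) :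
    (∃ (θ : ℕ → ℕ) (u₀ : FracSchrodinger.L2R N), StrictMono θ ∧
      FracSchrodinger.IsWeakDirichletSolution s Ω f u₀ ∧ u₀ ≠ 0 ∧
      Tendsto (fun n => FracSchrodinger.hsNorm s (u (θ n) - u₀)) atTop (𝓝 0)) ∧
    Tendsto (fun n => ∫ x in (V ⁻¹' {0})ᶜ, (u n x) ^ 2) atTop (𝓝 0) := by
  -- The uniform bounds need `λ ≥ 1`; dropping the first `m` terms secures this and affects neither
  -- conclusion.
  obtain ⟨m, hm⟩ := eventually_atTop.1 (hlam.eventually_ge_atTop 1)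
  obtain ⟨⟨θ, u₀, hθ, hsol, hne, hlim⟩, hconc⟩ :=
    FracSchrodinger.exists_subseq_tendsto_and_concentration N hN s hs0 hs1 V hVcont hVnonneg hVb Ω
      hΩ hΩne hΩsmooth hΩclosure f hf p hp1 hp2 ξ hξnonneg hξ hfξ η δ γ hη hδ hγ1 hγ2 hF
      (fun n => lam (n + m)) (fun n => hm _ (Nat.le_add_left m n))
      (hlam.comp (tendsto_add_atTop_nat m)) (fun n => u (n + m)) (fun n => hu _)
  exact ⟨⟨fun n => θ n + m, u₀, fun i j hij => Nat.add_lt_add_right (hθ hij) m, hsol, hne, hlim⟩,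
    (tendsto_add_atTop_iff_nat m).1 hconc⟩
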